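/- Let $s\ge 1$, let $q_1>q_2>\cdots>q_s>q_{s+1}=0$ be integers and $l_1,\dots,l_s$ positive integers, and put $N=\sum_{u=1}^s l_uq_u$, $L=l_1+\cdots+l_s$. Let $k\in\mathbb C$. For $1\le c\le L$ let $u(c)$ be the index $u$ with $l_1+\cdots+l_{u-1}<c\le l_1+\cdots+l_u$, and put $\zeta_c=k+N-q_{u(c)}$ and $\gamma_c=\sum_{c'=c+1}^{L}\zeta_{c'}$. Consider $N$ boxes, each with a column and a row: the column $c\in\{1,\dots,L\}$ consists of one box in each row $r$ with $q_1-q_{u(c)}<r\le q_1$. Index the matrix units $e_{i,j}$ of $\mathfrak{gl}(N)$ by these boxes. For a box $i$, let $\hat i$ (resp. $\tilde i$) be the box in the same row as $i$ and in column $\mathrm{col}(i)+1$ (resp. $\mathrm{col}(i)-1$), if it exists. Let $\mathfrak b=\bigoplus_{\mathrm{col}(i)\ge\mathrm{col}(j)}\mathbb C e_{i,j}\subset\mathfrak{gl}(N)$ with the invariant form $$\kappa(e_{i,j},e_{p,q})=\zeta_{\mathrm{col}(i)}\delta_{i,q}\delta_{p,j}+\delta_{\mathrm{col}(i),\mathrm{col}(p)}\delta_{i,j}\delta_{p,q},$$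 and let $\mathfrak a=\mathfrak b\oplus\bigoplus_{\mathrm{col}(i)>\mathrm{col}(j)}\mathbb C\psi_{i,j}$ be the Lie superalgebra with $\psi_{i,j}$ odd, $[e_{i,j},\psi_{p,q}]=\delta_{j,p}\psi_{i,q}-\delta_{i,q}\psi_{p,j}$ and $[\psi_{i,j},\psi_{p,q}]=0$; let $\tilde\kappa$ be the extension of $\kappa$ by zero. Let $V^\kappa(\mathfrak b)\subset V^{\tilde\kappa}(\mathfrak a)$ be the universal affine vertex (super)algebras, with translation operator $\partial$, write $x[-n]$ for the element $xt^{-n}$, and write products $XY$ for $X_{(-1)}Y$. There is an odd linear map $d_0\colon V^\kappa(\mathfrak b)\to V^{\tilde\kappa}(\mathfrak a)$ with $d_0|0\rangle=0$, $[d_0,\partial]=0$, and such that for all $i,j$ with $\mathrm{col}(i)\ge\mathrm{col}(j)$ and all $n\in\mathbb Z$ one has $[d_0,(e_{i,j}[-1])_{(n)}]=(D_{i,j})_{(n)}$, where $$D_{i,j}=\sum_{\mathrm{col}(i)>\mathrm{col}(r)\ge\mathrm{col}(j)}e_{r,j}[-1]\psi_{i,r}[-1]-\sum_{\mathrm{col}(j)<\mathrm{col}(r)\le\mathrm{col}(i)}\psi_{r,j}[-1]e_{i,r}[-1]+\delta(\mathrm{col}(i)>\mathrm{col}(j))\,\zeta_{\mathrm{col}(i)}\psi_{i,j}[-2]+\psi_{\hat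 i,j}[-1]-\psi_{i,\tilde j}[-1]$$ (so $d_0(e_{i,j}[-1])=D_{i,j}$); a term involving a non-existent $\hat i$ or $\tilde j$ is omitted. The $W$-algebra attached to these data is $\mathcal W^k=\{y\in V^\kappa(\mathfrak b)\mid d_0(y)=0\}$. **Theorem.** Let $1\le b\le a\le s$ and let $p,q$ be integers with $$q_1-q_a<q\le q_1-q_{a+1},\qquad q_1-q_b<p\le q_1-q_{b+1}.$$ Then the following two elements of $V^\kappa(\mathfrak b)$ belong to $\mathcal W^k$ (all sums are over boxes $i,j$, resp. $i,j,u,v$, with $\mathrm{row}(i)=p$, $\mathrm{row}(j)=q$ and the indicated conditions): $$W^{(1)}_{p,q}=\sum_{\mathrm{col}(i)=\mathrm{col}(j)}e_{i,j}[-1],$$ $$W^{(2)}_{p,q}=\sum_{\mathrm{col}(i)=\mathrm{col}(j)+1}e_{i,j}[-1]-\sum_{\mathrm{col}(i)=\mathrm{col}(j)}\gamma_{\mathrm{col}(i)}e_{i,j}[-2]+\sum_{\substack{\mathrm{col}(u)=\mathrm{col}(j)<\mathrm{col}(i)=\mathrm{col}(v)\\ \mathrm{row}(u)=\mathrm{row}(v)>q_1-q_a}}e_{u,j}[-1]e_{i,v}[-1]-\sum_{\substack{\mathrm{col}(u)=\mathrm{col}(j)\ge\mathrm{col}(i)=\mathrm{col}(v)\\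 \mathrm{row}(u)=\mathrm{row}(v)\le q_1-q_a}}e_{u,j}[-1]e_{i,v}[-1].$$ -/

import Mathlib

namespace WAlgebraTypeA

/-- The structure constants of a complex Lie superalgebra in a homogeneous basis indexed by `ι`,
together with the Gram matrix of an invariant bilinear form. -/
structure LieSuperTable (ι : Type) where
  odd : ι → Bool
  bracket : ι → ι → (ι →₀ ℂ)
  form : ι → ι → ℂ

namespace LieSuperTable

variable {ι : Type} (K : LieSuperTable ι)

/-- The Koszul sign `(-1)^{|x||y|}`. -/
def sign (x y : ι) : ℂ := if K.odd x && K.odd y then -1 else 1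

/-- The relations `x[m] y[n] - (-1)^{|x||y|} y[n] x[m] = [x,y][m+n] + m δ_{m+n,0} κ(x,y)`, with
the central element of the affinization set equal to `1`. -/
inductive AffRel : FreeAlgebra ℂ (ι × ℤ) → FreeAlgebra ℂ (ι × ℤ) → Prop
  | comm (x y : ι) (m n : ℤ) : AffRel
      (FreeAlgebra.ι ℂ (x, m) * FreeAlgebra.ι ℂ (y, n)
        - K.sign x y • (FreeAlgebra.ι ℂ (y, n) * FreeAlgebra.ι ℂ (x, m)))
      ((K.bracket x y).sum (fun z c => c • FreeAlgebra.ι ℂ (z, m + n))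
        + (if m + n = 0 then (m : ℂ) * K.form x y else 0) • 1)

/-- The universal enveloping algebra of the affine Lie superalgebra at level one
(the central element acts as `1`). -/
def Aff : Type := RingQuot K.AffRel

noncomputable instance : Ring K.Aff := inferInstanceAs (Ring (RingQuot K.AffRel))
noncomputable instance : Algebra ℂ K.Aff := inferInstanceAs (Algebra ℂ (RingQuot K.AffRel))

/-- The element `x[n] = x ⊗ t^n` of the enveloping algebra. -/
noncomputable def gen (x : ι) (n : ℤ) : K.Aff :=
  RingQuot.mkAlgHom ℂ K.AffRel (FreeAlgebra.ι ℂ (x, n))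

/-- The left ideal generated by all `x[n]` with `n ≥ 0`. -/
noncomputable def vacIdeal : Submodule K.Aff K.Aff :=
  Submodule.span K.Aff {a | ∃ (x : ι) (n : ℤ), 0 ≤ n ∧ a = K.gen x n}

/-- The universal affine vertex superalgebra, realised as the vacuum module
`U(ĝ) ⊗_{U(g[t] ⊕ ℂ1)} ℂ = U / U · g[t]`. -/
def VA : Type := K.Aff ⧸ K.vacIdeal

noncomputable instance : AddCommGroup K.VA := inferInstanceAs (AddCommGroup (K.Aff ⧸ K.vacIdeal))
noncomputable instance : Module K.Aff K.VA := inferInstanceAs (Module K.Aff (K.Aff ⧸ K.vacIdeal))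
noncomputable instance : Module ℂ K.VA := inferInstanceAs (Module ℂ (K.Aff ⧸ K.vacIdeal))
instance : IsScalarTower ℂ K.Aff K.VA :=
  inferInstanceAs (IsScalarTower ℂ K.Aff (K.Aff ⧸ K.vacIdeal))

/-- The vacuum vector. -/
noncomputable def vac : K.VA := Submodule.Quotient.mk (p := K.vacIdeal) 1

/-- The mode `x_{(n)} = x[n]` of the generating field `x(z) = ∑ x_{(n)} z^{-n-1}`. -/
noncomputable def mode (x : ι) (n : ℤ) : Module.End ℂ K.VA := Algebra.lsmul ℂ ℂ K.VA (K.gen x n)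

theorem mode_apply (x : ι) (n : ℤ) (v : K.VA) : K.mode x n v = K.gen x n • v := rfl

theorem gen_comm (x y : ι) (m n : ℤ) :
    K.gen x m * K.gen y n - K.sign x y • (K.gen y n * K.gen x m)
      = (K.bracket x y).sum (fun z c => c • K.gen z (m + n))
        + (if m + n = 0 then (m : ℂ) * K.form x y else 0) • 1 := by
  have h := RingQuot.mkAlgHom_rel ℂ (AffRel.comm (K := K) x y m n)
  rw [map_sub, map_add, map_smul, map_smul, map_mul, map_mul, map_one, Finsupp.sum,
    map_sum] at h
  simp only [map_smul] at h
  exact h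

theorem mode_comm (x y : ι) (m n : ℤ) :
    K.mode x m * K.mode y n - K.sign x y • (K.mode y n * K.mode x m)
      = (K.bracket x y).sum (fun z c => c • K.mode z (m + n))
        + (if m + n = 0 then (m : ℂ) * K.form x y else 0) • 1 := by
  have h := congrArg (Algebra.lsmul ℂ ℂ K.VA) (K.gen_comm x y m n)
  rw [map_sub, map_add, map_smul, map_smul, map_mul, map_mul, map_one, Finsupp.sum,
    map_sum] at h
  simp only [map_smul] at h
  exact h

theorem mode_vac (x : ι) (n : ℤ) (hn : 0 ≤ n) : K.mode x n K.vac = 0 := by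
  have : K.gen x n ∈ K.vacIdeal := Submodule.subset_span ⟨x, n, hn, rfl⟩
  have h2 := (Submodule.Quotient.mk_eq_zero K.vacIdeal).2 this
  rw [← mul_one (K.gen x n), ← smul_eq_mul] at h2
  exact h2

theorem aff_induction {C : K.Aff → Prop} (hc : ∀ c : ℂ, C (algebraMap ℂ K.Aff c))
    (hg : ∀ x n, C (K.gen x n)) (hm : ∀ a b, C a → C b → C (a * b))
    (ha : ∀ a b, C a → C b → C (a + b)) (a : K.Aff) : C a := by
  obtain ⟨w, rfl⟩ := RingQuot.mkAlgHom_surjective ℂ K.AffRel a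
  induction w using FreeAlgebra.induction with
  | grade0 r => rw [AlgHom.commutes]; exact hc r
  | grade1 x => exact hg x.1 x.2
  | mul a b h1 h2 => rw [map_mul]; exact hm _ _ h1 h2
  | add a b h1 h2 => rw [map_add]; exact ha _ _ h1 h2

/-- The vertex superalgebra is spanned by iterated modes applied to the vacuum. -/
theorem va_induction {C : K.VA → Prop} (h0 : C 0) (hvac : C K.vac)
    (ha : ∀ v w, C v → C w → C (v + w)) (hs : ∀ (c : ℂ) v, C v → C (c • v))
    (hm : ∀ x n v, C v → C (K.mode x n v)) (v : K.VA) : C v := by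
  obtain ⟨a, rfl⟩ := Submodule.Quotient.mk_surjective K.vacIdeal v
  have key : ∀ a : K.Aff, ∀ v, C v → C (a • v) := by
    intro a
    induction a using K.aff_induction with
    | hc c => intro v hv; rw [algebraMap_smul]; exact hs c v hv
    | hg x n => intro v hv; exact hm x n v hv
    | hm a b h1 h2 => intro v hv; rw [mul_smul]; exact h1 _ (h2 _ hv)
    | ha a b h1 h2 => intro v hv; rw [add_smul]; exact ha _ _ (h1 _ hv) (h2 _ hv)
  have := key a K.vac hvac
  have e : a • K.vac = Submodule.Quotient.mk (p := K.vacIdeal) a := by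
    change Submodule.Quotient.mk (a • (1 : K.Aff)) = _
    rw [smul_eq_mul, mul_one]
  rwa [e] at this

section lift

variable {M : Type} [AddCommGroup M] [Module ℂ M]

/-- `ρ` is a representation of the affine Lie superalgebra in which the central element acts
as `1`. -/
def IsRep (ρ : ι → ℤ → Module.End ℂ M) : Prop :=
  ∀ x y m n, ρ x m * ρ y n - K.sign x y • (ρ y n * ρ x m)
      = (K.bracket x y).sum (fun z c => c • ρ z (m + n))
        + (if m + n = 0 then (m : ℂ) * K.form x y else 0) • 1

noncomputable def affHom (ρ : ι → ℤ → Module.End ℂ M) (h : K.IsRep ρ) :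
    K.Aff →ₐ[ℂ] Module.End ℂ M :=
  RingQuot.liftAlgHom ℂ ⟨FreeAlgebra.lift ℂ (fun z : ι × ℤ => ρ z.1 z.2), by
    rintro _ _ ⟨x, y, m, n⟩
    rw [map_sub, map_add, map_smul, map_smul, map_mul, map_mul, map_one, Finsupp.sum, map_sum]
    simp only [map_smul, FreeAlgebra.lift_ι_apply]
    exact h x y m n⟩

theorem affHom_gen (ρ : ι → ℤ → Module.End ℂ M) (h : K.IsRep ρ) (x : ι) (n : ℤ) :
    K.affHom ρ h (K.gen x n) = ρ x n := by
  unfold affHom gen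
  erw [RingQuot.liftAlgHom_mkAlgHom_apply]
  simp

/-- The universal property of the vacuum module: a vector killed by all non-negative modes
determines a homomorphism. -/
noncomputable def lift (ρ : ι → ℤ → Module.End ℂ M) (h : K.IsRep ρ) (v₀ : M)
    (h₀ : ∀ x n, 0 ≤ n → ρ x n v₀ = 0) : K.VA →ₗ[ℂ] M :=
  ((K.vacIdeal.restrictScalars ℂ).liftQ
    ((LinearMap.applyₗ v₀) ∘ₗ (K.affHom ρ h).toLinearMap) (by
      intro a ha
      rw [Submodule.restrictScalars_mem] at ha
      rw [LinearMap.mem_ker]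
      refine Submodule.span_induction
        (p := fun a _ => ((LinearMap.applyₗ v₀) ∘ₗ (K.affHom ρ h).toLinearMap) a = 0)
        ?_ ?_ ?_ ?_ ha
      · rintro _ ⟨x, n, hn, rfl⟩
        simp [affHom_gen, h₀ x n hn]
      · simp
      · intro a b _ _ h1 h2; rw [map_add, h1, h2, add_zero]
      · intro a b _ h1
        simp only [LinearMap.coe_comp, Function.comp_apply, AlgHom.toLinearMap_apply,
          LinearMap.applyₗ_apply_apply, smul_eq_mul, map_mul, Module.End.mul_apply] at h1 ⊢
        rw [h1, map_zero])) ∘ₗ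
    (Submodule.Quotient.restrictScalarsEquiv ℂ K.vacIdeal).symm.toLinearMap

theorem lift_mk (ρ : ι → ℤ → Module.End ℂ M) (h : K.IsRep ρ) (v₀ : M)
    (h₀ : ∀ x n, 0 ≤ n → ρ x n v₀ = 0) (a : K.Aff) :
    K.lift ρ h v₀ h₀ (Submodule.Quotient.mk (p := K.vacIdeal) a) = K.affHom ρ h a v₀ := rfl

theorem lift_vac (ρ : ι → ℤ → Module.End ℂ M) (h : K.IsRep ρ) (v₀ : M)
    (h₀ : ∀ x n, 0 ≤ n → ρ x n v₀ = 0) : K.lift ρ h v₀ h₀ K.vac = v₀ := by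
  unfold vac
  rw [lift_mk, map_one, Module.End.one_apply]

theorem lift_mode (ρ : ι → ℤ → Module.End ℂ M) (h : K.IsRep ρ) (v₀ : M)
    (h₀ : ∀ x n, 0 ≤ n → ρ x n v₀ = 0) (x : ι) (n : ℤ) (v : K.VA) :
    K.lift ρ h v₀ h₀ (K.mode x n v) = ρ x n (K.lift ρ h v₀ h₀ v) := by
  obtain ⟨a, rfl⟩ := Submodule.Quotient.mk_surjective K.vacIdeal v
  change K.affHom ρ h (K.gen x n * a) v₀ = ρ x n (K.affHom ρ h a v₀)
  rw [map_mul, affHom_gen]; rfl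

end lift

theorem mode_isRep : K.IsRep K.mode := K.mode_comm

/-- The modes act locally nilpotently in the field sense: `x_{(n)} v = 0` for `n ≫ 0`. -/
theorem mode_smooth (v : K.VA) : ∀ x, ∃ N : ℤ, ∀ n, N ≤ n → K.mode x n v = 0 := by
  induction v using K.va_induction with
  | h0 => intro x; exact ⟨0, fun n _ => map_zero _⟩
  | hvac => intro x; exact ⟨0, fun n hn => K.mode_vac x n hn⟩
  | ha v w h1 h2 =>
    intro x
    obtain ⟨N, hN⟩ := h1 x
    obtain ⟨N', hN'⟩ := h2 x
    refine ⟨max N N', fun n hn => ?_⟩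
    rw [map_add, hN n (le_trans (le_max_left _ _) hn), hN' n (le_trans (le_max_right _ _) hn),
      add_zero]
  | hs c v h =>
    intro x
    obtain ⟨N, hN⟩ := h x
    exact ⟨N, fun n hn => by rw [map_smul, hN n hn, smul_zero]⟩
  | hm y k v h =>
    intro x
    obtain ⟨N, hN⟩ := h x
    choose f hf using h
    obtain ⟨B, hB⟩ := ((K.bracket x y).support.image f).exists_le
    refine ⟨max (max N (B - k)) (1 - k), fun n hn => ?_⟩
    have hn1 : N ≤ n := by omega
    have hn2 : B ≤ n + k := by omega
    have hn3 : n + k ≠ 0 := by omega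
    have hc := congrArg (fun T => T v) (K.mode_comm x y n k)
    simp only [LinearMap.sub_apply, Module.End.mul_apply, LinearMap.smul_apply, hN n hn1,
      map_zero, smul_zero, sub_zero, LinearMap.add_apply, if_neg hn3, zero_smul,
      LinearMap.zero_apply, add_zero, Finsupp.sum, LinearMap.sum_apply] at hc
    rw [hc]
    refine Finset.sum_eq_zero fun z hz => ?_
    rw [hf z (n + k) (le_trans (hB _ (Finset.mem_image_of_mem f hz)) hn2), smul_zero]


section triangular

variable {V W : Type} [AddCommGroup V] [Module ℂ V] [AddCommGroup W] [Module ℂ W]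

/-- The operator `(v, w) ↦ (A v, D v + B w)`. -/
def tri (A : Module.End ℂ V) (B : Module.End ℂ W) (D : V →ₗ[ℂ] W) : Module.End ℂ (V × W) :=
  (A ∘ₗ LinearMap.fst ℂ V W).prod (D ∘ₗ LinearMap.fst ℂ V W + B ∘ₗ LinearMap.snd ℂ V W)

theorem tri_apply (A : Module.End ℂ V) (B : Module.End ℂ W) (D : V →ₗ[ℂ] W) (z : V × W) :
    tri A B D z = (A z.1, D z.1 + B z.2) := rfl

/-- Two representations and a family of operators satisfying the Leibniz rule give a triangular
representation. -/
theorem isRep_tri {A : ι → ℤ → Module.End ℂ V} {B : ι → ℤ → Module.End ℂ W}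
    (hA : K.IsRep A) (hB : K.IsRep B) (D : ι → ℤ → V →ₗ[ℂ] W)
    (hD : ∀ x y m n v, D x m (A y n v) + B x m (D y n v)
      - K.sign x y • (D y n (A x m v) + B y n (D x m v))
        = (K.bracket x y).sum (fun z c => c • D z (m + n) v)) :
    K.IsRep (fun x n => tri (A x n) (B x n) (D x n)) := by
  intro x y m n
  refine LinearMap.ext fun z => ?_
  have h1 := congrArg (fun T => T z.1) (hA x y m n)
  have h2 := congrArg (fun T => T z.2) (hB x y m n)
  have h3 := hD x y m n z.1
  simp only [LinearMap.sub_apply, Module.End.mul_apply, LinearMap.smul_apply,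
    LinearMap.add_apply, Finsupp.sum, LinearMap.sum_apply, Module.End.one_apply, tri_apply]
    at h1 h2 h3 ⊢
  refine Prod.ext ?_ ?_
  · simp only [Prod.fst_sub, Prod.smul_fst, Prod.fst_add, Prod.fst_sum]
    exact h1
  · simp only [Prod.snd_sub, Prod.smul_snd, Prod.snd_add, Prod.snd_sum, smul_add,
      Finset.sum_add_distrib, map_add]
    rw [← h3, add_assoc, ← h2]
    simp only [smul_add]
    abel

end triangular

theorem transl_isRep : K.IsRep (fun x n =>
    tri (K.mode x n) (K.mode x n) (-((n : ℂ) • K.mode x (n - 1)))) := by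
  refine K.isRep_tri K.mode_isRep K.mode_isRep (fun x n => -((n : ℂ) • K.mode x (n - 1))) ?_
  intro x y m n v
  have h (m n : ℤ) := congrArg (fun T => T v) (K.mode_comm x y m n)
  have h2 := h (m - 1) n
  have h3 := h m (n - 1)
  rw [show m - 1 + n = m + n - 1 by ring] at h2
  rw [show m + (n - 1) = m + n - 1 by ring] at h3
  simp only [LinearMap.sub_apply, Module.End.mul_apply, LinearMap.smul_apply, LinearMap.neg_apply,
    LinearMap.add_apply, Finsupp.sum, LinearMap.sum_apply, Module.End.one_apply, map_neg,
    map_smul, smul_neg, Finset.sum_neg_distrib] at h2 h3 ⊢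
  have e : ∀ z, (K.bracket x y) z • ((m + n : ℤ) : ℂ) • K.mode z (m + n - 1) v =
      ((m + n : ℤ) : ℂ) • ((K.bracket x y) z • K.mode z (m + n - 1) v) := fun z => smul_comm _ _ _
  simp only [e, ← Finset.smul_sum]
  set S := ∑ i ∈ (K.bracket x y).support, (K.bracket x y) i • K.mode i (m + n - 1) v
  have hS : ((m + n : ℤ) : ℂ) • S =
      (m : ℂ) • (K.mode x (m - 1) (K.mode y n v) - K.sign x y • K.mode y n (K.mode x (m - 1) v))
      + (n : ℂ) • (K.mode x m (K.mode y (n - 1) v)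
          - K.sign x y • K.mode y (n - 1) (K.mode x m v)) := by
    rw [h2, h3]
    split_ifs with hh
    · have hn : (n : ℂ) = 1 - m := by
        have : n = 1 - m := by omega
        rw [this]; push_cast; ring
      push_cast
      rw [hn]
      module
    · push_cast
      module
  rw [hS]
  module

theorem transl_zero (x : ι) (n : ℤ) (hn : 0 ≤ n) :
    tri (K.mode x n) (K.mode x n) (-((n : ℂ) • K.mode x (n - 1))) (K.vac, (0 : K.VA)) = 0 := by
  rw [tri_apply, K.mode_vac x n hn]
  rcases hn.eq_or_lt with rfl | h
  · simp
  · simp [K.mode_vac x (n - 1) (by omega)]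

/-- The translation operator `∂`: the unique operator with `∂|0⟩ = 0` and
`[∂, x_{(n)}] = -n x_{(n-1)}`. -/
noncomputable def transl : Module.End ℂ K.VA :=
  LinearMap.snd ℂ K.VA K.VA ∘ₗ K.lift _ K.transl_isRep (K.vac, 0) K.transl_zero

theorem transl_vac : K.transl K.vac = 0 := by
  unfold transl
  rw [LinearMap.comp_apply, lift_vac]; rfl

theorem transl_mode (x : ι) (n : ℤ) (v : K.VA) :
    K.transl (K.mode x n v) = K.mode x n (K.transl v) - (n : ℂ) • K.mode x (n - 1) v := by
  have h1 : ∀ v, (K.lift _ K.transl_isRep (K.vac, 0) K.transl_zero v).1 = v := by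
    intro v
    induction v using K.va_induction with
    | h0 => rw [map_zero]; rfl
    | hvac => rw [lift_vac]
    | ha v w h1 h2 => rw [map_add, Prod.fst_add, h1, h2]
    | hs c v h => rw [map_smul, Prod.smul_fst, h]
    | hm x n v h => rw [lift_mode, tri_apply, h]
  unfold transl
  rw [LinearMap.comp_apply, lift_mode, tri_apply, h1]
  simp only [LinearMap.snd_apply, LinearMap.neg_apply, LinearMap.smul_apply,
    LinearMap.comp_apply]
  abel

end LieSuperTable

section NormalOrder

variable {V : Type} [AddCommGroup V] [Module ℂ V]

/-- The truncation condition for the modes of a field: `A_{(n)} v = 0` for `n ≫ 0`. -/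
def IsTrunc (A : ℤ → Module.End ℂ V) : Prop := ∀ v, ∃ N : ℤ, ∀ n, N ≤ n → A n v = 0

theorem IsTrunc.add {A B : ℤ → Module.End ℂ V} (hA : IsTrunc A) (hB : IsTrunc B) :
    IsTrunc (fun n => A n + B n) := by
  intro v
  obtain ⟨N, hN⟩ := hA v
  obtain ⟨N', hN'⟩ := hB v
  refine ⟨max N N', fun n hn => ?_⟩
  rw [LinearMap.add_apply, hN n (le_trans (le_max_left _ _) hn),
    hN' n (le_trans (le_max_right _ _) hn), add_zero]

theorem IsTrunc.smul {A : ℤ → Module.End ℂ V} (hA : IsTrunc A) (c : ℂ) :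
    IsTrunc (fun n => c • A n) := by
  intro v
  obtain ⟨N, hN⟩ := hA v
  exact ⟨N, fun n hn => by rw [LinearMap.smul_apply, hN n hn, smul_zero]⟩

theorem IsTrunc.zero : IsTrunc (fun _ => (0 : Module.End ℂ V)) := fun _ => ⟨0, fun _ _ => rfl⟩

/-- The `k`-th summand of the ordered product in which the modes `A_{(k)}` with `k < c` stand to
the left. -/
def cutTerm (A B : ℤ → Module.End ℂ V) (c m k : ℤ) (v : V) : V :=
  if k < c then A k (B (m - 1 - k) v) else B (m - 1 - k) (A k v)

theorem cutTerm_finite {A B : ℤ → Module.End ℂ V} (hA : IsTrunc A) (hB : IsTrunc B)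
    (c m : ℤ) (v : V) : (Function.support fun k => cutTerm A B c m k v).Finite := by
  obtain ⟨N, hN⟩ := hA v
  obtain ⟨N', hN'⟩ := hB v
  refine (Set.finite_Icc (min c (m - 1 - N')) (max c N)).subset fun k hk => ?_
  by_contra h
  apply hk
  rw [Set.mem_Icc, not_and_or] at h
  change (if k < c then A k (B (m - 1 - k) v) else B (m - 1 - k) (A k v)) = 0
  split_ifs with hc
  · have : k < m - 1 - N' := by omega
    rw [hN' _ (by omega), map_zero]
  · have : N ≤ k := by omega
    rw [hN _ this, map_zero]

/-- The ordered product with cut `c`; the normally ordered product is the case `c = 0`. -/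
noncomputable def cut (A B : ℤ → Module.End ℂ V) (c m : ℤ) (v : V) : V :=
  ∑ᶠ k : ℤ, cutTerm A B c m k v

theorem cutTerm_add_right (A B : ℤ → Module.End ℂ V) (c m k : ℤ) (v w : V) :
    cutTerm A B c m k (v + w) = cutTerm A B c m k v + cutTerm A B c m k w := by
  unfold cutTerm; split_ifs <;> simp

theorem cutTerm_smul_right (A B : ℤ → Module.End ℂ V) (c m k : ℤ) (a : ℂ) (v : V) :
    cutTerm A B c m k (a • v) = a • cutTerm A B c m k v := by
  unfold cutTerm; split_ifs <;> simp

/-- The `m`-th mode of the normally ordered product of two fields, at least one of which is even: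
`:AB:_{(m)} = ∑_{k < 0} A_{(k)} B_{(m-1-k)} + ∑_{k ≥ 0} B_{(m-1-k)} A_{(k)}`.
If `A`, `B` are the fields of the states `a`, `b`, this is the field of `a_{(-1)} b`. -/
noncomputable def nop {A B : ℤ → Module.End ℂ V} (hA : IsTrunc A) (hB : IsTrunc B) (m : ℤ) :
    Module.End ℂ V where
  toFun v := ∑ᶠ k : ℤ, if k < 0 then A k (B (m - 1 - k) v) else B (m - 1 - k) (A k v)
  map_add' v w := by
    change cut A B 0 m (v + w) = cut A B 0 m v + cut A B 0 m w
    unfold cut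
    rw [← finsum_add_distrib (cutTerm_finite hA hB 0 m v) (cutTerm_finite hA hB 0 m w)]
    exact finsum_congr fun k => cutTerm_add_right A B 0 m k v w
  map_smul' a v := by
    change cut A B 0 m (a • v) = a • cut A B 0 m v
    unfold cut
    rw [smul_finsum]
    exact finsum_congr fun k => cutTerm_smul_right A B 0 m k a v

theorem nop_apply {A B : ℤ → Module.End ℂ V} (hA : IsTrunc A) (hB : IsTrunc B) (m : ℤ) (v : V) :
    nop hA hB m v = cut A B 0 m v := rfl

theorem cut_add_left {A A' B : ℤ → Module.End ℂ V} (hA : IsTrunc A) (hA' : IsTrunc A')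
    (hB : IsTrunc B) (c m : ℤ) (v : V) :
    cut (fun n => A n + A' n) B c m v = cut A B c m v + cut A' B c m v := by
  unfold cut
  rw [← finsum_add_distrib (cutTerm_finite hA hB c m v) (cutTerm_finite hA' hB c m v)]
  refine finsum_congr fun k => ?_
  unfold cutTerm; split_ifs <;> simp

theorem cut_add_right {A B B' : ℤ → Module.End ℂ V} (hA : IsTrunc A) (hB : IsTrunc B)
    (hB' : IsTrunc B') (c m : ℤ) (v : V) :
    cut A (fun n => B n + B' n) c m v = cut A B c m v + cut A B' c m v := by
  unfold cut
  rw [← finsum_add_distrib (cutTerm_finite hA hB c m v) (cutTerm_finite hA hB' c m v)]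
  refine finsum_congr fun k => ?_
  unfold cutTerm; split_ifs <;> simp

theorem cut_smul_left (A B : ℤ → Module.End ℂ V) (a : ℂ) (c m : ℤ) (v : V) :
    cut (fun n => a • A n) B c m v = a • cut A B c m v := by
  unfold cut
  rw [smul_finsum]
  refine finsum_congr fun k => ?_
  unfold cutTerm; split_ifs <;> simp

theorem cut_smul_right (A B : ℤ → Module.End ℂ V) (a : ℂ) (c m : ℤ) (v : V) :
    cut A (fun n => a • B n) c m v = a • cut A B c m v := by
  unfold cut
  rw [smul_finsum]
  refine finsum_congr fun k => ?_
  unfold cutTerm; split_ifs <;> simp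

theorem cut_zero_left (B : ℤ → Module.End ℂ V) (c m : ℤ) (v : V) :
    cut (fun _ => 0) B c m v = 0 := by
  unfold cut cutTerm; simp

theorem cut_zero_right (A : ℤ → Module.End ℂ V) (c m : ℤ) (v : V) :
    cut A (fun _ => 0) c m v = 0 := by
  unfold cut cutTerm; simp

theorem cut_succ {A B : ℤ → Module.End ℂ V} (hA : IsTrunc A) (hB : IsTrunc B) (c m : ℤ) (v : V) :
    cut A B (c + 1) m v
      = cut A B c m v + (A c (B (m - 1 - c) v) - B (m - 1 - c) (A c v)) := by
  have h : cut A B (c + 1) m v - cut A B c m v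
      = A c (B (m - 1 - c) v) - B (m - 1 - c) (A c v) := by
    unfold cut
    rw [← finsum_sub_distrib (cutTerm_finite hA hB (c + 1) m v) (cutTerm_finite hA hB c m v)]
    rw [finsum_eq_single _ c]
    · unfold cutTerm; simp
    · intro k hk
      unfold cutTerm
      have : k < c + 1 ↔ k < c := by omega
      simp only [this, sub_self]
  rw [← h]; abel

theorem cut_int {A B : ℤ → Module.End ℂ V} (hA : IsTrunc A) (hB : IsTrunc B)
    {C : ℤ → Module.End ℂ V} (v : V) (hC : ∀ k l, A k (B l v) - B l (A k v) = C (k + l) v)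
    (n m : ℤ) : cut A B n m v = cut A B 0 m v + (n : ℂ) • C (m - 1) v := by
  have hs : ∀ c, cut A B (c + 1) m v = cut A B c m v + C (m - 1) v := by
    intro c
    rw [cut_succ hA hB, hC, show c + (m - 1 - c) = m - 1 by ring]
  induction n using Int.induction_on with
  | zero => simp
  | succ i ih => rw [hs, ih]; push_cast; module
  | pred i ih =>
    have h := hs (-i - 1)
    rw [show (-(i : ℤ) - 1 + 1) = -i by ring, ih] at h
    rw [← sub_eq_iff_eq_add] at h
    rw [← h]; push_cast; module

/-- Quasi-commutativity of the normally ordered product. -/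
theorem cut_swap {A B : ℤ → Module.End ℂ V} (hA : IsTrunc A) (hB : IsTrunc B)
    {C : ℤ → Module.End ℂ V} (v : V) (hC : ∀ k l, A k (B l v) - B l (A k v) = C (k + l) v)
    (m : ℤ) : cut B A 0 m v = cut A B 0 m v + (m : ℂ) • C (m - 1) v := by
  rw [← cut_int hA hB v hC m m]
  unfold cut
  rw [← finsum_comp_equiv (Equiv.subLeft (m - 1))]
  refine finsum_congr fun k => ?_
  simp only [Equiv.subLeft_apply]
  unfold cutTerm
  rw [show m - 1 - (m - 1 - k) = k by ring]
  by_cases h : k < m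
  · rw [if_pos h, if_neg (by omega)]
  · rw [if_neg h, if_pos (by omega)]

/-- The commutator of an operator with the modes of a normally ordered product. -/
theorem comm_cut {A B A' B' : ℤ → Module.End ℂ V} (hA : IsTrunc A) (hB : IsTrunc B)
    (hA' : IsTrunc A') (hB' : IsTrunc B') (Y : Module.End ℂ V) (n : ℤ) (a b : ℂ)
    (h1 : ∀ k v, Y (A k v) = A k (Y v) + A' (n + k) v + (if n + k = 0 then a else 0) • v)
    (h2 : ∀ k v, Y (B k v) = B k (Y v) + B' (n + k) v + (if n + k = 0 then b else 0) • v)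
    (m : ℤ) (v : V) :
    Y (cut A B 0 m v) = cut A B 0 m (Y v) + cut A' B n (m + n) v + cut A B' 0 (m + n) v
      + a • B (m + n - 1) v + b • A (m + n - 1) v := by
  have t : ∀ k, Y (cutTerm A B 0 m k v) = cutTerm A B 0 m k (Y v)
      + cutTerm A' B n (m + n) (k + n) v + cutTerm A B' 0 (m + n) k v
      + (if k = -n then a • B (m + n - 1) v else 0)
      + (if k = m + n - 1 then b • A (m + n - 1) v else 0) := by
    intro k
    have e1 : m + n - 1 - (k + n) = m - 1 - k := by ring
    have e2 : n + (m - 1 - k) = m + n - 1 - k := by ring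
    have c1 : (if n + k = 0 then a else 0) • B (m - 1 - k) v
        = if k = -n then a • B (m + n - 1) v else 0 := by
      by_cases h : k = -n
      · rw [if_pos (by omega), if_pos h, h]; congr 2; ring_nf
      · rw [if_neg (by omega), if_neg h, zero_smul]
    have c2 : (if n + (m - 1 - k) = 0 then b else 0) • A k v
        = if k = m + n - 1 then b • A (m + n - 1) v else 0 := by
      by_cases h : k = m + n - 1
      · rw [if_pos (by omega), if_pos h, h]
      · rw [if_neg (by omega), if_neg h, zero_smul]
    rw [← c1, ← c2]
    unfold cutTerm
    rw [e1]
    have hk : (k + n < n) ↔ k < 0 := by omega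
    simp only [hk]
    by_cases h0 : k < 0
    · simp only [if_pos h0]
      rw [h1, h2, map_add, map_add, map_smul, e2, add_comm n k]
      abel
    · simp only [if_neg h0]
      rw [h2, h1, map_add, map_add, map_smul, e2, add_comm n k]
      abel
  have f1 := cutTerm_finite hA hB 0 m (Y v)
  have f2 : (Function.support fun k => cutTerm A' B n (m + n) (k + n) v).Finite :=
    (cutTerm_finite hA' hB n (m + n) v).preimage (add_left_injective n).injOn
  have f3 := cutTerm_finite hA hB' 0 (m + n) v
  have f4 : (Function.support fun k : ℤ => if k = -n then a • B (m + n - 1) v else 0).Finite :=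
    (Set.finite_singleton (-n)).subset fun k hk => by
      by_contra h; exact hk (if_neg h)
  have f5 : (Function.support
      fun k : ℤ => if k = m + n - 1 then b • A (m + n - 1) v else 0).Finite :=
    (Set.finite_singleton (m + n - 1)).subset fun k hk => by
      by_contra h; exact hk (if_neg h)
  have f12 := (f1.union f2).subset (Function.support_add _ _)
  have f123 := (f12.union f3).subset (Function.support_add _ _)
  have f1234 := (f123.union f4).subset (Function.support_add _ _)
  have s2 : ∑ᶠ k, cutTerm A' B n (m + n) (k + n) v = cut A' B n (m + n) v := by
    unfold cut
    exact finsum_comp_equiv (Equiv.addRight n) (f := fun k => cutTerm A' B n (m + n) k v)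
  have s4 : ∑ᶠ k : ℤ, (if k = -n then a • B (m + n - 1) v else 0) = a • B (m + n - 1) v := by
    rw [finsum_eq_single _ (-n) (fun k hk => if_neg hk), if_pos rfl]
  have s5 : ∑ᶠ k : ℤ, (if k = m + n - 1 then b • A (m + n - 1) v else 0)
      = b • A (m + n - 1) v := by
    rw [finsum_eq_single _ (m + n - 1) (fun k hk => if_neg hk), if_pos rfl]
  have s0 : Y (cut A B 0 m v) = ∑ᶠ k, Y (cutTerm A B 0 m k v) := by
    unfold cut
    exact map_finsum Y (cutTerm_finite hA hB 0 m v)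
  rw [s0, finsum_congr t, finsum_add_distrib f1234 f5, finsum_add_distrib f123 f4,
    finsum_add_distrib f12 f3, finsum_add_distrib f1 f2, s2, s4, s5]
  rfl

/-- The translation operator is a derivation of the normally ordered product. -/
theorem transl_cut {A B : ℤ → Module.End ℂ V} (hA : IsTrunc A) (hB : IsTrunc B)
    (T : Module.End ℂ V)
    (h1 : ∀ k v, T (A k v) = A k (T v) - (k : ℂ) • A (k - 1) v)
    (h2 : ∀ k v, T (B k v) = B k (T v) - (k : ℂ) • B (k - 1) v) (m : ℤ) (v : V) :
    T (cut A B 0 m v) = cut A B 0 m (T v) - (m : ℂ) • cut A B 0 (m - 1) v := by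
  have t : ∀ k, T (cutTerm A B 0 m k v) = cutTerm A B 0 m k (T v)
      - (k : ℂ) • cutTerm A B 0 (m - 1) (k - 1) v
      - ((m - 1 - k : ℤ) : ℂ) • cutTerm A B 0 (m - 1) k v := by
    intro k
    rcases eq_or_ne k 0 with rfl | hk
    · unfold cutTerm
      simp only [lt_irrefl, if_false, h1, h2, Int.cast_zero, zero_smul, sub_zero]
    · unfold cutTerm
      have hk' : k - 1 < 0 ↔ k < 0 := by omega
      rw [show m - 1 - 1 - (k - 1) = m - 1 - k by ring,
        show m - 1 - 1 - k = m - 1 - k - 1 by ring]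
      simp only [hk']
      split_ifs <;> simp only [h1, h2, map_sub, map_smul] <;> abel
  have f1 := cutTerm_finite hA hB 0 m (T v)
  have f3 := cutTerm_finite hA hB 0 (m - 1) v
  have f2 : (Function.support fun k : ℤ =>
      (k : ℂ) • cutTerm A B 0 (m - 1) (k - 1) v).Finite :=
    (f3.preimage (sub_left_injective (b := (1 : ℤ))).injOn).subset fun k hk => by
      intro h
      apply hk
      change (k : ℂ) • cutTerm A B 0 (m - 1) (k - 1) v = 0
      rw [show cutTerm A B 0 (m - 1) (k - 1) v = 0 from h, smul_zero]
  have f3' : (Function.support fun k : ℤ =>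
      ((m - 1 - k : ℤ) : ℂ) • cutTerm A B 0 (m - 1) k v).Finite :=
    f3.subset fun k hk h => hk (by
      change ((m - 1 - k : ℤ) : ℂ) • cutTerm A B 0 (m - 1) k v = 0
      rw [show cutTerm A B 0 (m - 1) k v = 0 from h, smul_zero])
  have f3'' : (Function.support fun k : ℤ =>
      ((k + 1 : ℤ) : ℂ) • cutTerm A B 0 (m - 1) k v).Finite :=
    f3.subset fun k hk h => hk (by
      change ((k + 1 : ℤ) : ℂ) • cutTerm A B 0 (m - 1) k v = 0
      rw [show cutTerm A B 0 (m - 1) k v = 0 from h, smul_zero])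
  have f12 := (f1.union f2).subset (Function.support_sub _ _)
  have s2 : ∑ᶠ k : ℤ, (k : ℂ) • cutTerm A B 0 (m - 1) (k - 1) v
      = ∑ᶠ k : ℤ, ((k + 1 : ℤ) : ℂ) • cutTerm A B 0 (m - 1) k v := by
    rw [← finsum_comp_equiv (Equiv.addRight (1 : ℤ))]
    refine finsum_congr fun k => ?_
    simp
  have s0 : T (cut A B 0 m v) = ∑ᶠ k, T (cutTerm A B 0 m k v) := by
    unfold cut
    exact map_finsum T (cutTerm_finite hA hB 0 m v)
  rw [s0, finsum_congr t, finsum_sub_distrib f12 f3', finsum_sub_distrib f1 f2, s2, sub_sub,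
    ← finsum_add_distrib f3'' f3']
  congr 1
  unfold cut
  rw [smul_finsum]
  refine finsum_congr fun k => ?_
  rw [← add_smul]
  congr 1
  push_cast; ring

/-- The normally ordered product of creation fields applied to the vacuum is the
`(-1)`-product of states. -/
theorem cut_vac {A B : ℤ → Module.End ℂ V} (v : V) (h1 : ∀ n, 0 ≤ n → A n v = 0)
    (h2 : ∀ n, 0 ≤ n → B n v = 0) : cut A B 0 (-1) v = A (-1) (B (-1) v) := by
  unfold cut
  rw [finsum_eq_single _ (-1)]
  · unfold cutTerm; simp
  · intro k hk
    unfold cutTerm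
    split_ifs with h
    · rw [h2 _ (by omega), map_zero]
    · rw [h1 _ (by omega), map_zero]

end NormalOrder

section Leibniz

/-- Kronecker's delta. -/
def dl {I : Type} [DecidableEq I] (a b : I) : ℂ := if a = b then 1 else 0

theorem dl_self {I : Type} [DecidableEq I] (a : I) : dl a a = 1 := if_pos rfl

theorem dl_ne {I : Type} [DecidableEq I] {a b : I} (h : a ≠ b) : dl a b = 0 := if_neg h

variable {I : Type} [Fintype I] [DecidableEq I]
variable {V : Type} [AddCommGroup V] [Module ℂ V]

/-- The form `ζ_{col i} δ_{iq} δ_{pj} + δ_{col i, col p} δ_{ij} δ_{pq}`. -/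
def colForm (col : I → ℕ) (ζ : ℕ → ℂ) (i j p q : I) : ℂ :=
  ζ (col i) * (dl i q * dl p j) + dl (col i) (col p) * (dl i j * dl p q)

/-- Families of modes satisfying the commutation relations of `e_{i,j}` and `ψ_{i,j}`. -/
structure ColModes (col : I → ℕ) (ζ : ℕ → ℂ) (E P : I → I → ℤ → Module.End ℂ V) : Prop where
  E_zero : ∀ i j, ¬ col j ≤ col i → ∀ n v, E i j n v = 0
  P_zero : ∀ i j, ¬ col j < col i → ∀ n v, P i j n v = 0
  E_trunc : ∀ i j, IsTrunc (E i j)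
  P_trunc : ∀ i j, IsTrunc (P i j)
  EP : ∀ i j p q, col j ≤ col i → col q < col p → ∀ k l v,
    E i j k (P p q l v) = P p q l (E i j k v) + dl j p • P i q (k + l) v
      - dl i q • P p j (k + l) v
  EE : ∀ i j p q, col j ≤ col i → col q ≤ col p → ∀ k l v,
    E i j k (E p q l v) = E p q l (E i j k v) + dl j p • E i q (k + l) v
      - dl i q • E p j (k + l) v
      + (if k + l = 0 then (k : ℂ) * colForm col ζ i j p q else 0) • v

variable {col : I → ℕ} {ζ : ℕ → ℂ} {E P : I → I → ℤ → Module.End ℂ V}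

theorem cut_left_eq_zero {A : ℤ → Module.End ℂ V} (h : ∀ n v, A n v = 0)
    (B : ℤ → Module.End ℂ V) (c m : ℤ) (v : V) : cut A B c m v = 0 := by
  have : A = fun _ => 0 := funext fun n => LinearMap.ext fun v => h n v
  rw [this, cut_zero_left]

theorem cut_right_eq_zero {B : ℤ → Module.End ℂ V} (h : ∀ n v, B n v = 0)
    (A : ℤ → Module.End ℂ V) (c m : ℤ) (v : V) : cut A B c m v = 0 := by
  have : B = fun _ => 0 := funext fun n => LinearMap.ext fun v => h n v
  rw [this, cut_zero_right]

namespace ColModes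


theorem comm1 (H : ColModes col ζ E P) (p q i j r : I) (hpq : col q ≤ col p) (h1 : col j ≤ col r) (h2 : col r < col i)
    (m n : ℤ) (v : V) :
    E p q n (cut (E r j) (P i r) 0 m v) = cut (E r j) (P i r) 0 m (E p q n v)
      + dl q r • cut (E p j) (P i r) 0 (m + n) v - dl p j • cut (E r q) (P i r) 0 (m + n) v
      + dl q i • cut (E r j) (P p r) 0 (m + n) v - dl p r • cut (E r j) (P i q) 0 (m + n) v
      + (n : ℂ) • ((-(dl q r * dl p r)) • P i j (m + n - 1) v + dl p j • P i q (m + n - 1) v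
        + colForm col ζ p q r j • P i r (m + n - 1) v) := by
  have tA' : IsTrunc (fun k => dl q r • E p j k + (-dl p j) • E r q k) :=
    ((H.E_trunc p j).smul _).add ((H.E_trunc r q).smul _)
  have tB' : IsTrunc (fun k => dl q i • P p r k + (-dl p r) • P i q k) :=
    ((H.P_trunc p r).smul _).add ((H.P_trunc i q).smul _)
  have key := comm_cut (H.E_trunc r j) (H.P_trunc i r) tA' tB' (E p q n) n
    ((n : ℂ) * colForm col ζ p q r j) 0
    (by
      intro k v
      rw [H.EE p q r j hpq h1]
      simp only [LinearMap.add_apply, LinearMap.smul_apply]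
      module)
    (by
      intro k v
      rw [H.EP p q i r hpq h2]
      simp only [LinearMap.add_apply, LinearMap.smul_apply, ite_self]
      module) m v
  have hC : ∀ k l, (fun k => dl q r • E p j k + (-dl p j) • E r q k) k (P i r l v)
      - P i r l ((fun k => dl q r • E p j k + (-dl p j) • E r q k) k v)
      = (fun k => (-(dl q r * dl p r)) • P i j k + dl p j • P i q k) (k + l) v := by
    intro k l
    simp only [LinearMap.add_apply, LinearMap.smul_apply, map_add, map_smul]
    have e1 : dl q r • E p j k (P i r l v) = dl q r • P i r l (E p j k v)
        + (-(dl q r * dl p r)) • P i j (k + l) v := by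
      by_cases hq : q = r
      · subst hq
        rw [H.EP p j i q (by omega) h2, dl_ne (a := j) (b := i) (by rintro rfl; omega)]
        module
      · rw [dl_ne hq]; module
    have e2 : dl p j • E r q k (P i r l v) = dl p j • P i r l (E r q k v)
        - dl p j • P i q (k + l) v := by
      by_cases hq : p = j
      · subst hq
        rw [H.EP r q i r (by omega) h2, dl_self r, H.P_zero r r (by omega)]
        module
      · rw [dl_ne hq]; module
    rw [e1, neg_smul, neg_smul, neg_smul, e2]
    module
  have s1 : (fun k => dl q r • E p j k + (-dl p j) • E r q k)
      = fun k => (fun k => dl q r • E p j k) k + (fun k => (-dl p j) • E r q k) k := rfl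
  have s2 : (fun k => dl q i • P p r k + (-dl p r) • P i q k)
      = fun k => (fun k => dl q i • P p r k) k + (fun k => (-dl p r) • P i q k) k := rfl
  rw [cut_int (C := fun k => (-(dl q r * dl p r)) • P i j k + dl p j • P i q k)
    tA' (H.P_trunc i r) v hC n (m + n)] at key
  rw [s1, s2, cut_add_left ((H.E_trunc p j).smul _) ((H.E_trunc r q).smul _) (H.P_trunc i r),
    cut_add_right (H.E_trunc r j) ((H.P_trunc p r).smul _) ((H.P_trunc i q).smul _),
    cut_smul_left, cut_smul_left, cut_smul_right, cut_smul_right] at key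
  rw [key]
  simp only [LinearMap.add_apply, LinearMap.smul_apply]
  module

theorem comm2 (H : ColModes col ζ E P) (p q i j r : I) (hpq : col q ≤ col p) (h1 : col j < col r) (h2 : col r ≤ col i)
    (m n : ℤ) (v : V) :
    E p q n (cut (P r j) (E i r) 0 m v) = cut (P r j) (E i r) 0 m (E p q n v)
      + dl q r • cut (P p j) (E i r) 0 (m + n) v - dl p j • cut (P r q) (E i r) 0 (m + n) v
      + dl q i • cut (P r j) (E p r) 0 (m + n) v - dl p r • cut (P r j) (E i q) 0 (m + n) v
      + (n : ℂ) • ((-(dl q r * dl p r)) • P i j (m + n - 1) v + dl p j • P i q (m + n - 1) v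
        + colForm col ζ p q i r • P r j (m + n - 1) v) := by
  have tA' : IsTrunc (fun k => dl q r • P p j k + (-dl p j) • P r q k) :=
    ((H.P_trunc p j).smul _).add ((H.P_trunc r q).smul _)
  have tB' : IsTrunc (fun k => dl q i • E p r k + (-dl p r) • E i q k) :=
    ((H.E_trunc p r).smul _).add ((H.E_trunc i q).smul _)
  have key := comm_cut (H.P_trunc r j) (H.E_trunc i r) tA' tB' (E p q n) n
    0 ((n : ℂ) * colForm col ζ p q i r)
    (by
      intro k v
      rw [H.EP p q r j hpq h1]
      simp only [LinearMap.add_apply, LinearMap.smul_apply, ite_self]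
      module)
    (by
      intro k v
      rw [H.EE p q i r hpq h2]
      simp only [LinearMap.add_apply, LinearMap.smul_apply]
      module) m v
  have hC : ∀ k l, (fun k => dl q r • P p j k + (-dl p j) • P r q k) k (E i r l v)
      - E i r l ((fun k => dl q r • P p j k + (-dl p j) • P r q k) k v)
      = (fun k => (-(dl q r * dl p r)) • P i j k + dl p j • P i q k) (k + l) v := by
    intro k l
    simp only [LinearMap.add_apply, LinearMap.smul_apply, map_add, map_smul]
    have e1 : dl q r • E i r l (P p j k v) = dl q r • P p j k (E i r l v)
        + (dl q r * dl p r) • P i j (k + l) v := by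
      by_cases hq : q = r
      · subst hq
        rw [H.EP i q p j h2 (by omega), dl_ne (a := i) (b := j) (by rintro rfl; omega),
          add_comm l k]
        by_cases hp : p = q
        · subst hp; module
        · rw [dl_ne hp, dl_ne (Ne.symm hp)]; module
      · rw [dl_ne hq]; module
    have e2 : dl p j • E i r l (P r q k v) = dl p j • P r q k (E i r l v)
        + dl p j • P i q (k + l) v := by
      by_cases hq : p = j
      · subst hq
        rw [H.EP i r r q h2 (by omega), dl_self r, H.P_zero r r (by omega), add_comm l k]
        module
      · rw [dl_ne hq]; module
    rw [e1, neg_smul, neg_smul, neg_smul, e2]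
    module
  have s1 : (fun k => dl q r • P p j k + (-dl p j) • P r q k)
      = fun k => (fun k => dl q r • P p j k) k + (fun k => (-dl p j) • P r q k) k := rfl
  have s2 : (fun k => dl q i • E p r k + (-dl p r) • E i q k)
      = fun k => (fun k => dl q i • E p r k) k + (fun k => (-dl p r) • E i q k) k := rfl
  rw [cut_int (C := fun k => (-(dl q r * dl p r)) • P i j k + dl p j • P i q k)
    tA' (H.E_trunc i r) v hC n (m + n)] at key
  rw [s1, s2, cut_add_left ((H.P_trunc p j).smul _) ((H.P_trunc r q).smul _) (H.E_trunc i r),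
    cut_add_right (H.P_trunc r j) ((H.E_trunc p r).smul _) ((H.E_trunc i q).smul _),
    cut_smul_left, cut_smul_left, cut_smul_right, cut_smul_right] at key
  rw [key]
  simp only [LinearMap.add_apply, LinearMap.smul_apply]
  module

end ColModes

theorem sum_dl (q : I) (g : I → ℂ) (f : I → V) : ∑ r, (g r * dl q r) • f r = g q • f q := by
  rw [Finset.sum_eq_single q]
  · rw [dl_self, mul_one]
  · intro b _ hb
    rw [dl_ne (Ne.symm hb), mul_zero, zero_smul]
  · intro h; exact absurd (Finset.mem_univ q) h

theorem dl_comm {J : Type} [DecidableEq J] (a b : J) : dl a b = dl b a := by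
  unfold dl; simp only [eq_comm]

/-- Indicator of `col j ≤ col r < col i`. -/
def win1 (col : I → ℕ) (i j r : I) : ℂ := if col j ≤ col r ∧ col r < col i then 1 else 0

/-- Indicator of `col j < col r ≤ col i`. -/
def win2 (col : I → ℕ) (i j r : I) : ℂ := if col j < col r ∧ col r ≤ col i then 1 else 0

theorem win_count (col : I → ℕ) (i j : I) (h : col j ≤ col i) :
    ∑ r, win2 col i j r - ∑ r, win1 col i j r
      = ∑ r, dl (col r) (col i) - ∑ r, dl (col r) (col j) := by
  rw [← Finset.sum_sub_distrib, ← Finset.sum_sub_distrib]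
  refine Finset.sum_congr rfl fun r _ => ?_
  unfold win1 win2 dl
  split_ifs <;> first | omega | norm_num

namespace ColModes


/-- Modes of the first quadratic term of the differential. -/
noncomputable def S1 (_ : ColModes col ζ E P) (i j : I) (m : ℤ) (v : V) : V :=
  ∑ r, cut (E r j) (P i r) 0 m v

/-- Modes of the second quadratic term of the differential. -/
noncomputable def S2 (_ : ColModes col ζ E P) (i j : I) (m : ℤ) (v : V) : V :=
  ∑ r, cut (P r j) (E i r) 0 m v


theorem cut1_zero (H : ColModes col ζ E P) (a b c d : I) (h : ¬ (col b ≤ col a ∧ col d < col c)) (k m : ℤ) (v : V) :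
    cut (E a b) (P c d) k m v = 0 := by
  by_cases h1 : col b ≤ col a
  · exact cut_right_eq_zero (H.P_zero c d fun h2 => h ⟨h1, h2⟩) _ _ _ _
  · exact cut_left_eq_zero (H.E_zero a b h1) _ _ _ _

theorem cut2_zero (H : ColModes col ζ E P) (a b c d : I) (h : ¬ (col b < col a ∧ col d ≤ col c)) (k m : ℤ) (v : V) :
    cut (P a b) (E c d) k m v = 0 := by
  by_cases h1 : col b < col a
  · exact cut_right_eq_zero (H.E_zero c d fun h2 => h ⟨h1, h2⟩) _ _ _ _
  · exact cut_left_eq_zero (H.P_zero a b h1) _ _ _ _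

theorem sum1 (H : ColModes col ζ E P) (p q i j : I) (hpq : col q ≤ col p) (m n : ℤ) (v : V) :
    E p q n (H.S1 i j m v) = H.S1 i j m (E p q n v)
      + (win1 col i j q - win1 col i j p) • cut (E p j) (P i q) 0 (m + n) v
      - dl p j • ∑ r, win1 col i j r • cut (E r q) (P i r) 0 (m + n) v
      + dl q i • ∑ r, win1 col i j r • cut (E r j) (P p r) 0 (m + n) v
      + (n : ℂ) • ((-(win1 col i j q * dl p q)) • P i j (m + n - 1) v
        + dl p j • (∑ r, win1 col i j r) • P i q (m + n - 1) v
        + (ζ (col p) * dl p j * win1 col i j q) • P i q (m + n - 1) v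
        + (dl p q * win1 col i j j * dl (col p) (col j)) • P i j (m + n - 1) v) := by
  have t : ∀ r, E p q n (cut (E r j) (P i r) 0 m v) = cut (E r j) (P i r) 0 m (E p q n v)
      + (win1 col i j r * dl q r) • cut (E p j) (P i r) 0 (m + n) v
      - dl p j • win1 col i j r • cut (E r q) (P i r) 0 (m + n) v
      + dl q i • win1 col i j r • cut (E r j) (P p r) 0 (m + n) v
      - (win1 col i j r * dl p r) • cut (E r j) (P i q) 0 (m + n) v
      + (n : ℂ) • ((win1 col i j r * dl q r) • (-(dl p r)) • P i j (m + n - 1) v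
        + dl p j • win1 col i j r • P i q (m + n - 1) v
        + (win1 col i j r * dl q r) • (ζ (col p) * dl p j) • P i r (m + n - 1) v
        + (win1 col i j r * dl j r) • (dl p q * dl (col p) (col r)) • P i r (m + n - 1) v) := by
    intro r
    by_cases h : col j ≤ col r ∧ col r < col i
    · rw [H.comm1 p q i j r hpq h.1 h.2, show win1 col i j r = 1 from if_pos h]
      unfold colForm
      rw [dl_comm r q, dl_comm r j]
      module
    · rw [H.cut1_zero r j i r h, H.cut1_zero r j i r h, map_zero,
        show win1 col i j r = 0 from if_neg h]
      module
  unfold S1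
  rw [map_sum, Finset.sum_congr rfl fun r _ => t r]
  simp only [Finset.sum_add_distrib, Finset.sum_sub_distrib, ← Finset.smul_sum, sum_dl]
  rw [← Finset.sum_smul]
  module

theorem sum2 (H : ColModes col ζ E P) (p q i j : I) (hpq : col q ≤ col p) (m n : ℤ) (v : V) :
    E p q n (H.S2 i j m v) = H.S2 i j m (E p q n v)
      + (win2 col i j q - win2 col i j p) • cut (P p j) (E i q) 0 (m + n) v
      - dl p j • ∑ r, win2 col i j r • cut (P r q) (E i r) 0 (m + n) v
      + dl q i • ∑ r, win2 col i j r • cut (P r j) (E p r) 0 (m + n) v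
      + (n : ℂ) • ((-(win2 col i j q * dl p q)) • P i j (m + n - 1) v
        + dl p j • (∑ r, win2 col i j r) • P i q (m + n - 1) v
        + (ζ (col p) * dl q i * win2 col i j p) • P p j (m + n - 1) v
        + (dl p q * win2 col i j i * dl (col p) (col i)) • P i j (m + n - 1) v) := by
  have t : ∀ r, E p q n (cut (P r j) (E i r) 0 m v) = cut (P r j) (E i r) 0 m (E p q n v)
      + (win2 col i j r * dl q r) • cut (P p j) (E i r) 0 (m + n) v
      - dl p j • win2 col i j r • cut (P r q) (E i r) 0 (m + n) v
      + dl q i • win2 col i j r • cut (P r j) (E p r) 0 (m + n) v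
      - (win2 col i j r * dl p r) • cut (P r j) (E i q) 0 (m + n) v
      + (n : ℂ) • ((win2 col i j r * dl q r) • (-(dl p r)) • P i j (m + n - 1) v
        + dl p j • win2 col i j r • P i q (m + n - 1) v
        + (win2 col i j r * dl p r) • (ζ (col p) * dl q i) • P r j (m + n - 1) v
        + (win2 col i j r * dl i r) • (dl p q * dl (col p) (col i)) • P r j (m + n - 1) v) := by
    intro r
    by_cases h : col j < col r ∧ col r ≤ col i
    · rw [H.comm2 p q i j r hpq h.1 h.2, show win2 col i j r = 1 from if_pos h]
      unfold colForm
      rw [dl_comm i q]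
      module
    · rw [H.cut2_zero r j i r h, H.cut2_zero r j i r h, map_zero,
        show win2 col i j r = 0 from if_neg h]
      module
  unfold S2
  rw [map_sum, Finset.sum_congr rfl fun r _ => t r]
  simp only [Finset.sum_add_distrib, Finset.sum_sub_distrib, ← Finset.smul_sum, sum_dl]
  rw [← Finset.sum_smul]
  module

theorem swap_term (H : ColModes col ζ E P) (p q i j : I) (M : ℤ) (v : V) :
    (win1 col i j p - win1 col i j q) • cut (E p j) (P i q) 0 M v
      = (win2 col p q j - win2 col p q i) • cut (P i q) (E p j) 0 M v := by
  by_cases h : col j ≤ col p ∧ col q < col i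
  · have hC : ∀ k l, E p j k (P i q l v) - P i q l (E p j k v)
        = (fun k => dl j i • P p q k - dl p q • P i j k) (k + l) v := by
      intro k l
      rw [H.EP p j i q h.1 h.2]
      simp only [LinearMap.sub_apply, LinearMap.smul_apply]
      abel
    rw [cut_swap (C := fun k => dl j i • P p q k - dl p q • P i j k)
      (H.E_trunc p j) (H.P_trunc i q) v hC M]
    have hs : win2 col p q j - win2 col p q i = win1 col i j p - win1 col i j q := by
      unfold win1 win2
      split_ifs <;> first | omega | norm_num
    rw [hs]
    have h0 : (win1 col i j p - win1 col i j q) * dl j i = 0 := by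
      by_cases hji : j = i
      · subst hji
        unfold win1
        split_ifs <;> first | omega | norm_num
      · rw [dl_ne hji, mul_zero]
    have h1 : (win1 col i j p - win1 col i j q) * dl p q = 0 := by
      by_cases hji : p = q
      · subst hji
        rw [sub_self, zero_mul]
      · rw [dl_ne hji, mul_zero]
    simp only [LinearMap.sub_apply, LinearMap.smul_apply]
    have e : ∀ (a b c d M : ℂ) (x y z : V), a * b = 0 → a * c = 0 →
        a • x = a • (x + M • (b • y - c • z)) := by
      intro a b c d M x y z hb hc
      have : a • (x + M • (b • y - c • z)) = a • x + (M * (a * b)) • y - (M * (a * c)) • z := by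
        module
      rw [this, hb, hc]; module
    exact e _ _ _ 0 _ _ _ _ h0 h1
  · rw [H.cut1_zero p j i q h, H.cut2_zero i q p j (by tauto), smul_zero, smul_zero]

theorem S1_split (H : ColModes col ζ E P) (p q i j : I) (hpq : col q ≤ col p) (hij : col j ≤ col i) (M : ℤ) (v : V) :
    dl p j • ∑ r, win1 col i j r • cut (E r q) (P i r) 0 M v
      + dl p j • ∑ r, win1 col p q r • cut (E r q) (P i r) 0 M v = dl p j • H.S1 i q M v := by
  by_cases h : p = j
  · subst h
    rw [← smul_add, ← Finset.sum_add_distrib]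
    unfold S1
    congr 1
    refine Finset.sum_congr rfl fun r _ => ?_
    by_cases hr : col q ≤ col r ∧ col r < col i
    · have : win1 col i p r + win1 col p q r = 1 := by
        unfold win1
        split_ifs <;> first | omega | norm_num
      rw [← add_smul, this, one_smul]
    · rw [H.cut1_zero r q i r hr, smul_zero, smul_zero, add_zero]
  · rw [dl_ne h]; module

theorem S2_split (H : ColModes col ζ E P) (p q i j : I) (hpq : col q ≤ col p) (hij : col j ≤ col i) (M : ℤ) (v : V) :
    dl p j • ∑ r, win2 col i j r • cut (P r q) (E i r) 0 M v
      + dl p j • ∑ r, win2 col p q r • cut (P r q) (E i r) 0 M v = dl p j • H.S2 i q M v := by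
  by_cases h : p = j
  · subst h
    rw [← smul_add, ← Finset.sum_add_distrib]
    unfold S2
    congr 1
    refine Finset.sum_congr rfl fun r _ => ?_
    by_cases hr : col q < col r ∧ col r ≤ col i
    · have : win2 col i p r + win2 col p q r = 1 := by
        unfold win2
        split_ifs <;> first | omega | norm_num
      rw [← add_smul, this, one_smul]
    · rw [H.cut2_zero r q i r hr, smul_zero, smul_zero, add_zero]
  · rw [dl_ne h]; module

theorem anom1 (H : ColModes col ζ E P) (p q i j : I) (k : ℤ) (v : V) :
    (dl p q * (win1 col i j q - win1 col i j j * dl (col p) (col j) - win2 col i j q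
      + win2 col i j i * dl (col p) (col i))) • P i j k v = 0 := by
  by_cases h : p = q
  · by_cases hc : col j < col i
    · subst h
      have : win1 col i j p - win1 col i j j * dl (col p) (col j) - win2 col i j p
          + win2 col i j i * dl (col p) (col i) = 0 := by
        unfold win1 win2 dl
        split_ifs <;> first | omega | norm_num
      rw [this, mul_zero, zero_smul]
    · rw [H.P_zero i j hc, smul_zero]
  · rw [dl_ne h, zero_mul, zero_smul]

theorem anom2 (H : ColModes col ζ E P) (hζ : ∀ i j, ζ (col i) + ∑ r, dl (col r) (col i) = ζ (col j) + ∑ r, dl (col r) (col j))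
    (p q i j : I) (hpq : col q ≤ col p) (hij : col j ≤ col i) (m n : ℂ) (k : ℤ) (v : V) :
    (dl p j * (-(n * (∑ r, win1 col i j r + ζ (col p) * win1 col i j q))
      + n * ∑ r, win2 col i j r - m * (ζ (col i) * (if col j < col i then 1 else 0))
      - m * (ζ (col i) * win2 col p q i) - n * (ζ (col p) * (if col q < col p then 1 else 0))
      + (m + n) * ζ (col i))) • P i q k v = 0 := by
  by_cases h : p = j
  · by_cases hc : col q < col i
    · subst h
      have h1 := win_count col i p hij
      have h2 := hζ i p
      have h3 : ∑ r, win2 col i p r = ∑ r, win1 col i p r + ζ (col p) - ζ (col i) := by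
        linear_combination h1 + h2
      rw [h3]
      have : (-(n * (∑ r, win1 col i p r + ζ (col p) * win1 col i p q))
          + n * (∑ r, win1 col i p r + ζ (col p) - ζ (col i))
          - m * (ζ (col i) * (if col p < col i then 1 else 0))
          - m * (ζ (col i) * win2 col p q i) - n * (ζ (col p) * (if col q < col p then 1 else 0))
          + (m + n) * ζ (col i)) = 0 := by
        unfold win1 win2
        split_ifs <;> first | omega | ring
      rw [this, mul_zero, zero_smul]
    · rw [H.P_zero i q hc, smul_zero]
  · rw [dl_ne h, zero_mul, zero_smul]

/-- The Leibniz rule for the quadratic part together with the derivative term. -/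
theorem leibniz_quad (H : ColModes col ζ E P)
    (hζ : ∀ i j, ζ (col i) + ∑ r, dl (col r) (col i) = ζ (col j) + ∑ r, dl (col r) (col j))
    (i j p q : I) (hij : col j ≤ col i) (hpq : col q ≤ col p) (m n : ℤ) (v : V) :
    let Q := fun (i j : I) (m : ℤ) (v : V) =>
      H.S1 i j m v - H.S2 i j m v - ((m : ℂ) * ζ (col i)) • P i j (m - 1) v
    Q i j m (E p q n v) + E i j m (Q p q n v) - (Q p q n (E i j m v) + E p q n (Q i j m v))
      = dl j p • Q i q (m + n) v - dl i q • Q p j (m + n) v := by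
  intro Q
  simp only [Q, map_sub, map_smul]
  have z1 : E p q n (P i j (m - 1) v) = P i j (m - 1) (E p q n v)
      + (if col j < col i then (1 : ℂ) else 0) • (dl q i • P p j (m + n - 1) v
        - dl p j • P i q (m + n - 1) v) := by
    split_ifs with h
    · rw [H.EP p q i j hpq h, show n + (m - 1) = m + n - 1 by ring]; module
    · rw [H.P_zero i j h, H.P_zero i j h, map_zero]; module
  have z2 : E i j m (P p q (n - 1) v) = P p q (n - 1) (E i j m v)
      + (if col q < col p then (1 : ℂ) else 0) • (dl j p • P i q (m + n - 1) v
        - dl i q • P p j (m + n - 1) v) := by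
    split_ifs with h
    · rw [H.EP i j p q hij h, show m + (n - 1) = m + n - 1 by ring]; module
    · rw [H.P_zero p q h, H.P_zero p q h, map_zero]; module
  rw [z1, z2, H.sum1 p q i j hpq, H.sum1 i j p q hij, H.sum2 p q i j hpq, H.sum2 i j p q hij,
    show n + m = m + n by ring]
  have a1 := H.anom1 p q i j (m + n - 1) v
  have a1' := H.anom1 i j p q (m + n - 1) v
  have a2 := H.anom2 hζ p q i j hpq hij m n (m + n - 1) v
  have a2' := H.anom2 hζ i j p q hij hpq n m (m + n - 1) v
  have s := H.swap_term p q i j (m + n) v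
  have s' := H.swap_term i j p q (m + n) v
  have b1 := H.S1_split p q i j hpq hij (m + n) v
  have b1' := H.S1_split i j p q hij hpq (m + n) v
  have b2 := H.S2_split p q i j hpq hij (m + n) v
  have b2' := H.S2_split i j p q hij hpq (m + n) v
  rw [dl_comm q i, dl_comm j p]
  push_cast
  linear_combination (norm := module) b1 - b1' - b2 + b2' + s - s' + (n : ℂ) • a1 - (m : ℂ) • a1' + a2 - a2'

theorem leibniz_lin (H : ColModes col ζ E P) (h : I → I → ℂ)
    (hh : ∀ r i, h r i ≠ 0 → col r = col i + 1)
    (i j p q : I) (hij : col j ≤ col i) (hpq : col q ≤ col p) (m n : ℤ) (v : V) :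
    let F := fun (i j : I) (m : ℤ) (v : V) =>
      ∑ r, h r i • P r j m v - ∑ r, h j r • P i r m v
    F i j m (E p q n v) + E i j m (F p q n v) - (F p q n (E i j m v) + E p q n (F i j m v))
      = dl j p • F i q (m + n) v - dl i q • F p j (m + n) v := by
  intro F
  have t : ∀ i j p q : I, col j ≤ col i → col q ≤ col p → ∀ (m n : ℤ) (v : V),
      E p q n (F i j m v) = F i j m (E p q n v) + h q i • P p j (m + n) v
        - dl p j • ∑ r, h r i • P r q (m + n) v - dl q i • ∑ r, h j r • P p r (m + n) v
        + h j p • P i q (m + n) v := by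
    intro i j p q hij hpq m n v
    have t1 : ∀ r, E p q n (h r i • P r j m v) = h r i • P r j m (E p q n v)
        + (h r i * dl q r) • P p j (m + n) v - dl p j • h r i • P r q (m + n) v := by
      intro r
      by_cases hr : h r i = 0
      · rw [hr]; simp
      · have := hh r i hr
        rw [map_smul, H.EP p q r j hpq (by omega), add_comm n m]
        module
    have t2 : ∀ r, E p q n (h j r • P i r m v) = h j r • P i r m (E p q n v)
        + dl q i • h j r • P p r (m + n) v - (h j r * dl p r) • P i q (m + n) v := by
      intro r
      by_cases hr : h j r = 0
      · rw [hr]; simp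
      · have := hh j r hr
        rw [map_smul, H.EP p q i r hpq (by omega), add_comm n m]
        module
    simp only [F]
    rw [map_sub, map_sum, map_sum, Finset.sum_congr rfl fun r _ => t1 r,
      Finset.sum_congr rfl fun r _ => t2 r]
    simp only [Finset.sum_add_distrib, Finset.sum_sub_distrib, ← Finset.smul_sum, sum_dl]
    module
  rw [t i j p q hij hpq, t p q i j hpq hij, dl_comm p j, dl_comm q i]
  simp only [F]
  rw [show n + m = m + n by ring]
  module

end ColModes

end Leibniz

/-- The combinatorial data `s`, `q₁ > q₂ > ⋯ > q_s > q_{s+1} = 0` and `l₁, …, l_s > 0`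
(only the values `q u` for `1 ≤ u ≤ s + 1` and `l u` for `1 ≤ u ≤ s` are used). -/
structure Pyramid where
  s : ℕ
  q : ℕ → ℕ
  l : ℕ → ℕ
  s_pos : 1 ≤ s
  q_anti : ∀ u, 1 ≤ u → u ≤ s → q (u + 1) < q u
  q_last : q (s + 1) = 0
  l_pos : ∀ u, 1 ≤ u → u ≤ s → 0 < l u

namespace Pyramid

variable (Q : Pyramid)

/-- `N = ∑ l_u q_u`. -/
def N : ℕ := ∑ u ∈ Finset.Icc 1 Q.s, Q.l u * Q.q u

/-- The number `l₁ + ⋯ + l_s` of columns. -/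
def width : ℕ := ∑ u ∈ Finset.Icc 1 Q.s, Q.l u

/-- The index `u` of the block of columns containing column `c`:
`l₁ + ⋯ + l_{u-1} < c ≤ l₁ + ⋯ + l_u`. -/
def block (c : ℕ) : ℕ :=
  1 + ((Finset.Icc 1 Q.s).filter (fun v => ∑ w ∈ Finset.Icc 1 v, Q.l w < c)).card

/-- The height `q_u` of column `c`, where `u` is the block of `c`. -/
def height (c : ℕ) : ℕ := Q.q (Q.block c)

/-- The pairs (column, row) of the boxes: column `c` occupies the rows
`q₁ - height c < r ≤ q₁`. -/
def boxes : Finset (ℕ × ℕ) :=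
  (Finset.Icc 1 Q.width ×ˢ Finset.Icc 1 (Q.q 1)).filter (fun x => Q.q 1 - Q.height x.1 < x.2)

/-- The `N` boxes. They index the rows and columns of the matrices in `gl(N)`. -/
abbrev Box : Type := {x : ℕ × ℕ // x ∈ Q.boxes}

/-- The column of a box. -/
def col {Q : Pyramid} (i : Q.Box) : ℕ := i.1.1

/-- The row of a box. -/
def row {Q : Pyramid} (i : Q.Box) : ℕ := i.1.2

theorem block_mem (c : ℕ) : 1 ≤ Q.block c ∧ Q.block c ≤ Q.s + 1 := by
  refine ⟨Nat.le_add_right _ _, ?_⟩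
  unfold block
  have := Finset.card_filter_le (Finset.Icc 1 Q.s) (fun v => ∑ w ∈ Finset.Icc 1 v, Q.l w < c)
  rw [Nat.card_Icc] at this
  omega

theorem q_le (u : ℕ) (h1 : 1 ≤ u) (h2 : u ≤ Q.s + 1) : Q.q u ≤ Q.q 1 := by
  induction u, h1 using Nat.le_induction with
  | base => exact le_rfl
  | succ n hn ih => exact le_trans (Q.q_anti n hn (by omega)).le (ih (by omega))

/-- A column contains as many boxes as its height. -/
theorem card_col (i : Q.Box) :
    (Finset.univ.filter (fun r : Q.Box => col r = col i)).card = Q.height (col i) := by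
  have hle : Q.height (col i) ≤ Q.q 1 := Q.q_le _ (Q.block_mem _).1 (Q.block_mem _).2
  have hi : 1 ≤ col i ∧ col i ≤ Q.width := by
    have := i.2
    unfold boxes at this
    rw [Finset.mem_filter, Finset.mem_product, Finset.mem_Icc] at this
    exact this.1.1
  have : (Finset.univ.filter (fun r : Q.Box => col r = col i)).card
      = (Finset.Ioc (Q.q 1 - Q.height (col i)) (Q.q 1)).card := by
    refine Finset.card_bij (fun r _ => row r) ?_ ?_ ?_
    · intro r hr
      have hr' := r.2
      unfold boxes at hr'
      rw [Finset.mem_filter, Finset.mem_product, Finset.mem_Icc, Finset.mem_Icc] at hr'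
      rw [Finset.mem_filter] at hr
      rw [Finset.mem_Ioc, ← hr.2]
      exact ⟨hr'.2, hr'.1.2.2⟩
    · intro r hr t ht h
      rw [Finset.mem_filter] at hr ht
      exact Subtype.ext (Prod.ext (hr.2.trans ht.2.symm) h)
    · intro y hy
      rw [Finset.mem_Ioc] at hy
      refine ⟨⟨(col i, y), ?_⟩, ?_, rfl⟩
      · unfold boxes
        rw [Finset.mem_filter, Finset.mem_product, Finset.mem_Icc, Finset.mem_Icc]
        exact ⟨⟨hi, by dsimp only; omega, hy.2⟩, hy.1⟩
      · rw [Finset.mem_filter]; exact ⟨Finset.mem_univ _, rfl⟩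
  rw [this, Nat.card_Ioc]
  omega

/-- `ζ_c = k + N - q_u`, where `u` is the block of the column `c`. -/
def zeta (k : ℂ) (c : ℕ) : ℂ := k + Q.N - Q.height c

/-- `γ_c = ∑_{b > c} ζ_b`. -/
def gamma (k : ℂ) (c : ℕ) : ℂ := ∑ b ∈ Finset.Icc (c + 1) Q.width, Q.zeta k b

theorem zeta_const (k : ℂ) (i j : Q.Box) :
    Q.zeta k (col i) + ∑ r : Q.Box, dl (col r) (col i)
      = Q.zeta k (col j) + ∑ r : Q.Box, dl (col r) (col j) := by
  have h : ∀ i : Q.Box, ∑ r : Q.Box, dl (col r) (col i) = Q.height (col i) := by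
    intro i
    rw [← Q.card_col i]
    unfold dl
    rw [Finset.sum_boole]
  rw [h, h]
  unfold zeta
  ring

/-- The index set of the basis `e_{i,j}`, `col i ≥ col j`, of `𝔟`. -/
abbrev BIdx : Type := {x : Q.Box × Q.Box // col x.2 ≤ col x.1}

/-- The index set of the elements `ψ_{i,j}`, `col i > col j`. -/
abbrev NIdx : Type := {x : Q.Box × Q.Box // col x.2 < col x.1}

/-- The basis vector `e_{i,j}` of `𝔟`, and `0` if `col i < col j`. -/
noncomputable def bE (i j : Q.Box) : Q.BIdx →₀ ℂ :=
  if h : col j ≤ col i then Finsupp.single ⟨(i, j), h⟩ 1 else 0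

/-- The Lie algebra `𝔟 = ⨁_{col i ≥ col j} ℂ e_{i,j} ⊆ gl(N)` with the form
`κ(e_{i,j}, e_{p,q}) = ζ_{col i} δ_{iq} δ_{pj} + δ_{col i, col p} δ_{ij} δ_{pq}`. -/
noncomputable def bTable (k : ℂ) : LieSuperTable Q.BIdx where
  odd _ := false
  bracket x y := dl x.1.2 y.1.1 • Q.bE x.1.1 y.1.2 - dl x.1.1 y.1.2 • Q.bE y.1.1 x.1.2
  form x y := colForm col (Q.zeta k) x.1.1 x.1.2 y.1.1 y.1.2

/-- The basis vector `e_{i,j}` of `𝔞`, and `0` if `col i < col j`. -/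
noncomputable def aE (i j : Q.Box) : Q.BIdx ⊕ Q.NIdx →₀ ℂ :=
  if h : col j ≤ col i then Finsupp.single (Sum.inl ⟨(i, j), h⟩) 1 else 0

/-- The basis vector `ψ_{i,j}` of `𝔞`, and `0` if `col i ≤ col j`. -/
noncomputable def aPsi (i j : Q.Box) : Q.BIdx ⊕ Q.NIdx →₀ ℂ :=
  if h : col j < col i then Finsupp.single (Sum.inr ⟨(i, j), h⟩) 1 else 0

/-- The bracket `[e_{i,j}, ψ_{p,q}] = δ_{jp} ψ_{i,q} - δ_{iq} ψ_{p,j}`. -/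
noncomputable def brEPsi (x : Q.BIdx) (y : Q.NIdx) : Q.BIdx ⊕ Q.NIdx →₀ ℂ :=
  dl x.1.2 y.1.1 • Q.aPsi x.1.1 y.1.2 - dl x.1.1 y.1.2 • Q.aPsi y.1.1 x.1.2

/-- The Lie superalgebra `𝔞 = 𝔟 ⊕ ⨁_{col i > col j} ℂ ψ_{i,j}` with odd elements `ψ_{i,j}` and the
extension of the form of `𝔟` by zero. -/
noncomputable def aTable (k : ℂ) : LieSuperTable (Q.BIdx ⊕ Q.NIdx) where
  odd x := x.isRight
  bracket x y := match x, y with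
    | Sum.inl x, Sum.inl y =>
      dl x.1.2 y.1.1 • Q.aE x.1.1 y.1.2 - dl x.1.1 y.1.2 • Q.aE y.1.1 x.1.2
    | Sum.inl x, Sum.inr y => Q.brEPsi x y
    | Sum.inr x, Sum.inl y => - Q.brEPsi y x
    | Sum.inr _, Sum.inr _ => 0
  form x y := match x, y with
    | Sum.inl x, Sum.inl y => (Q.bTable k).form x y
    | Sum.inl _, Sum.inr _ => 0
    | Sum.inr _, Sum.inl _ => 0
    | Sum.inr _, Sum.inr _ => 0

/-- The universal affine vertex algebra `V^κ(𝔟)`. -/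
abbrev Vb (k : ℂ) : Type := (Q.bTable k).VA

/-- The universal affine vertex superalgebra `V^κ̃(𝔞)`. -/
abbrev Va (k : ℂ) : Type := (Q.aTable k).VA

/-- The operator `e_{i,j}[n] = (e_{i,j}[-1])_{(n)}` on `V^κ(𝔟)` (`0` if `col i < col j`). -/
noncomputable def eb (k : ℂ) (i j : Q.Box) (n : ℤ) : Module.End ℂ (Q.Vb k) :=
  if h : col j ≤ col i then (Q.bTable k).mode ⟨(i, j), h⟩ n else 0

/-- The operator `e_{i,j}[n] = (e_{i,j}[-1])_{(n)}` on `V^κ̃(𝔞)` (`0` if `col i < col j`). -/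
noncomputable def ea (k : ℂ) (i j : Q.Box) (n : ℤ) : Module.End ℂ (Q.Va k) :=
  if h : col j ≤ col i then (Q.aTable k).mode (Sum.inl ⟨(i, j), h⟩) n else 0

/-- The operator `ψ_{i,j}[n] = (ψ_{i,j}[-1])_{(n)}` on `V^κ̃(𝔞)` (`0` if `col i ≤ col j`). -/
noncomputable def psi (k : ℂ) (i j : Q.Box) (n : ℤ) : Module.End ℂ (Q.Va k) :=
  if h : col j < col i then (Q.aTable k).mode (Sum.inr ⟨(i, j), h⟩) n else 0

theorem ea_trunc (k : ℂ) (i j : Q.Box) : IsTrunc (Q.ea k i j) := by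
  unfold ea
  split_ifs with h
  · exact fun v => (Q.aTable k).mode_smooth v _
  · exact IsTrunc.zero

theorem psi_trunc (k : ℂ) (i j : Q.Box) : IsTrunc (Q.psi k i j) := by
  unfold psi
  split_ifs with h
  · exact fun v => (Q.aTable k).mode_smooth v _
  · exact IsTrunc.zero

theorem lc_aE (k : ℂ) (i j : Q.Box) (n : ℤ) (v : Q.Va k) :
    (Q.aE i j).sum (fun z c => c • (Q.aTable k).mode z n v) = Q.ea k i j n v := by
  unfold aE ea
  split_ifs with h
  · rw [Finsupp.sum_single_index, one_smul]; exact zero_smul _ _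
  · rfl

theorem lc_aPsi (k : ℂ) (i j : Q.Box) (n : ℤ) (v : Q.Va k) :
    (Q.aPsi i j).sum (fun z c => c • (Q.aTable k).mode z n v) = Q.psi k i j n v := by
  unfold aPsi psi
  split_ifs with h
  · rw [Finsupp.sum_single_index, one_smul]; exact zero_smul _ _
  · rfl

theorem lc_sub {J W : Type} [AddCommGroup W] [Module ℂ W] (f : J → W) (a b : ℂ)
    (x y : J →₀ ℂ) : (a • x - b • y).sum (fun z c => c • f z)
      = a • x.sum (fun z c => c • f z) - b • y.sum (fun z c => c • f z) := by
  change Finsupp.linearCombination ℂ f (a • x - b • y)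
    = a • Finsupp.linearCombination ℂ f x - b • Finsupp.linearCombination ℂ f y
  rw [map_sub, map_smul, map_smul]

/-- The commutation relations of the modes on `V^κ̃(𝔞)`. -/
theorem colModes (k : ℂ) : ColModes col (Q.zeta k) (Q.ea k) (Q.psi k) where
  E_zero i j h n v := by unfold ea; rw [dif_neg h]; rfl
  P_zero i j h n v := by unfold psi; rw [dif_neg h]; rfl
  E_trunc := Q.ea_trunc k
  P_trunc := Q.psi_trunc k
  EP i j p q h1 h2 m n v := by
    have h := congrArg (fun T => T v)
      ((Q.aTable k).mode_comm (Sum.inl ⟨(i, j), h1⟩) (Sum.inr ⟨(p, q), h2⟩) m n)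
    have hs : (Q.aTable k).sign (Sum.inl ⟨(i, j), h1⟩) (Sum.inr ⟨(p, q), h2⟩) = 1 := rfl
    have hf : (Q.aTable k).form (Sum.inl ⟨(i, j), h1⟩) (Sum.inr ⟨(p, q), h2⟩) = 0 := rfl
    have hb : (Q.aTable k).bracket (Sum.inl ⟨(i, j), h1⟩) (Sum.inr ⟨(p, q), h2⟩)
      = dl j p • Q.aPsi i q - dl i q • Q.aPsi p j := rfl
    simp only [LinearMap.sub_apply, Module.End.mul_apply, LinearMap.smul_apply,
      LinearMap.add_apply, Finsupp.sum, LinearMap.sum_apply] at h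
    change _ = ((Q.aTable k).bracket (Sum.inl ⟨(i, j), h1⟩) (Sum.inr ⟨(p, q), h2⟩)).sum
      (fun z c => c • (Q.aTable k).mode z (m + n) v) + _ at h
    rw [hs, hf, hb, lc_sub, lc_aPsi, lc_aPsi] at h
    unfold ea
    rw [dif_pos h1]
    nth_rewrite 1 [psi]
    nth_rewrite 1 [psi]
    rw [dif_pos h2]
    simp only [mul_zero, ite_self, zero_smul, add_zero, one_smul] at h
    rw [sub_eq_iff_eq_add] at h
    rw [h]; abel
  EE i j p q h1 h2 m n v := by
    have h := congrArg (fun T => T v)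
      ((Q.aTable k).mode_comm (Sum.inl ⟨(i, j), h1⟩) (Sum.inl ⟨(p, q), h2⟩) m n)
    have hs : (Q.aTable k).sign (Sum.inl ⟨(i, j), h1⟩) (Sum.inl ⟨(p, q), h2⟩) = 1 := rfl
    have hf : (Q.aTable k).form (Sum.inl ⟨(i, j), h1⟩) (Sum.inl ⟨(p, q), h2⟩)
      = colForm col (Q.zeta k) i j p q := rfl
    have hb : (Q.aTable k).bracket (Sum.inl ⟨(i, j), h1⟩) (Sum.inl ⟨(p, q), h2⟩)
      = dl j p • Q.aE i q - dl i q • Q.aE p j := rfl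
    simp only [LinearMap.sub_apply, Module.End.mul_apply, LinearMap.smul_apply,
      LinearMap.add_apply, Finsupp.sum, LinearMap.sum_apply, Module.End.one_apply] at h
    change _ = ((Q.aTable k).bracket (Sum.inl ⟨(i, j), h1⟩) (Sum.inl ⟨(p, q), h2⟩)).sum
      (fun z c => c • (Q.aTable k).mode z (m + n) v) + _ at h
    rw [hs, hf, hb, lc_sub, lc_aE, lc_aE, one_smul, sub_eq_iff_eq_add] at h
    have e1 : Q.ea k i j m = (Q.aTable k).mode (Sum.inl ⟨(i, j), h1⟩) m := dif_pos h1
    have e2 : Q.ea k p q n = (Q.aTable k).mode (Sum.inl ⟨(p, q), h2⟩) n := dif_pos h2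
    rw [e1, e2, h]; abel

/-- The modes `(d₀ e_{i,j}[-1])_{(m)}` of the field of the state
`∑_{col i > col r ≥ col j} e_{r,j}[-1] ψ_{i,r}[-1] - ∑_{col j < col r ≤ col i} ψ_{r,j}[-1] e_{i,r}[-1]
  + δ(col i > col j) ζ_{col i} ψ_{i,j}[-2] + ψ_{î,j}[-1] - ψ_{i,j̃}[-1]`.
Here `î` (resp. `j̃`) is the box in the same row and the next (resp. previous) column, and the
corresponding term is absent if there is no such box. The field of `ψ_{i,j}[-2]` is the derivative
of that of `ψ_{i,j}[-1]`, with modes `-m ψ_{i,j}[m-1]`. -/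
noncomputable def dField (k : ℂ) (i j : Q.Box) (m : ℤ) : Module.End ℂ (Q.Va k) :=
  (∑ r : Q.Box with col j ≤ col r ∧ col r < col i, nop (Q.ea_trunc k r j) (Q.psi_trunc k i r) m)
    - (∑ r : Q.Box with col j < col r ∧ col r ≤ col i,
        nop (Q.psi_trunc k r j) (Q.ea_trunc k i r) m)
    + (if col j < col i then Q.zeta k (col i) • (-(m : ℂ) • Q.psi k i j (m - 1)) else 0)
    + (∑ r : Q.Box with col r = col i + 1 ∧ row r = row i, Q.psi k r j m)
    - (∑ r : Q.Box with col r + 1 = col j ∧ row r = row j, Q.psi k i r m)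

/-- Indicator of `r = î`. -/
def hatInd (r i : Q.Box) : ℂ := if col r = col i + 1 ∧ row r = row i then 1 else 0

theorem dField_apply (k : ℂ) (i j : Q.Box) (m : ℤ) (v : Q.Va k) :
    Q.dField k i j m v = ((Q.colModes k).S1 i j m v - (Q.colModes k).S2 i j m v
        - ((m : ℂ) * Q.zeta k (col i)) • Q.psi k i j (m - 1) v)
      + (∑ r, Q.hatInd r i • Q.psi k r j m v - ∑ r, Q.hatInd j r • Q.psi k i r m v) := by
  have s1 : (∑ r : Q.Box with col j ≤ col r ∧ col r < col i,
      nop (Q.ea_trunc k r j) (Q.psi_trunc k i r) m) v = (Q.colModes k).S1 i j m v := by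
    unfold ColModes.S1
    rw [LinearMap.sum_apply, Finset.sum_filter]
    refine Finset.sum_congr rfl fun r _ => ?_
    split_ifs with h
    · rfl
    · rw [(Q.colModes k).cut1_zero _ _ _ _ h]
  have s2 : (∑ r : Q.Box with col j < col r ∧ col r ≤ col i,
      nop (Q.psi_trunc k r j) (Q.ea_trunc k i r) m) v = (Q.colModes k).S2 i j m v := by
    unfold ColModes.S2
    rw [LinearMap.sum_apply, Finset.sum_filter]
    refine Finset.sum_congr rfl fun r _ => ?_
    split_ifs with h
    · rfl
    · rw [(Q.colModes k).cut2_zero _ _ _ _ h]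
  have s3 : (if col j < col i then Q.zeta k (col i) • (-(m : ℂ) • Q.psi k i j (m - 1)) else 0) v
      = -(((m : ℂ) * Q.zeta k (col i)) • Q.psi k i j (m - 1) v) := by
    split_ifs with h
    · simp only [LinearMap.smul_apply]; module
    · rw [(Q.colModes k).P_zero i j h, smul_zero, neg_zero]; rfl
  have s4 : (∑ r : Q.Box with col r = col i + 1 ∧ row r = row i, Q.psi k r j m) v
      = ∑ r, Q.hatInd r i • Q.psi k r j m v := by
    rw [LinearMap.sum_apply, Finset.sum_filter]
    refine Finset.sum_congr rfl fun r _ => ?_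
    unfold hatInd
    split_ifs
    · rw [one_smul]
    · rw [zero_smul]
  have s5 : (∑ r : Q.Box with col r + 1 = col j ∧ row r = row j, Q.psi k i r m) v
      = ∑ r, Q.hatInd j r • Q.psi k i r m v := by
    rw [LinearMap.sum_apply, Finset.sum_filter]
    refine Finset.sum_congr rfl fun r _ => ?_
    unfold hatInd
    by_cases h : col r + 1 = col j ∧ row r = row j
    · rw [if_pos h, if_pos ⟨h.1.symm, h.2.symm⟩, one_smul]
    · rw [if_neg h, if_neg fun h' => h ⟨h'.1.symm, h'.2.symm⟩, zero_smul]
  unfold dField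
  rw [LinearMap.sub_apply, LinearMap.add_apply, LinearMap.add_apply, LinearMap.sub_apply,
    s1, s2, s3, s4, s5]
  abel

/-- Compatibility of the prescribed values of the differential with the commutation relations. -/
theorem dField_leibniz (k : ℂ) (i j p q : Q.Box) (hij : col j ≤ col i) (hpq : col q ≤ col p)
    (m n : ℤ) (v : Q.Va k) :
    Q.dField k i j m (Q.ea k p q n v) + Q.ea k i j m (Q.dField k p q n v)
      - (Q.dField k p q n (Q.ea k i j m v) + Q.ea k p q n (Q.dField k i j m v))
    = dl j p • Q.dField k i q (m + n) v - dl i q • Q.dField k p j (m + n) v := by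
  have h1 := (Q.colModes k).leibniz_quad (Q.zeta_const k) i j p q hij hpq m n v
  have h2 := (Q.colModes k).leibniz_lin Q.hatInd (by
    intro r i h
    by_contra h'
    exact h (if_neg fun h'' => h' h''.1)) i j p q hij hpq m n v
  simp only at h1 h2
  simp only [dField_apply]
  rw [map_add, map_add]
  linear_combination (norm := module) h1 + h2

theorem lc_bE (k : ℂ) {W : Type} [AddCommGroup W] [Module ℂ W] (f : Q.Box → Q.Box → W)
    (h0 : ∀ i j, ¬ col j ≤ col i → f i j = 0) (i j : Q.Box) :
    (Q.bE i j).sum (fun z c => c • f z.1.1 z.1.2) = f i j := by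
  unfold bE
  split_ifs with h
  · rw [Finsupp.sum_single_index, one_smul]; exact zero_smul _ _
  · rw [h0 i j h]; rfl

/-- `V^κ̃(𝔞)` is a representation of the affinization of `𝔟`. -/
theorem incl_isRep (k : ℂ) :
    (Q.bTable k).IsRep (fun x n => Q.ea k x.1.1 x.1.2 n) := by
  intro x y m n
  have hs : (Q.bTable k).sign x y = 1 := rfl
  have hb : (Q.bTable k).bracket x y
    = dl x.1.2 y.1.1 • Q.bE x.1.1 y.1.2 - dl x.1.1 y.1.2 • Q.bE y.1.1 x.1.2 := rfl
  have h0 : ∀ i j, ¬ col j ≤ col i → Q.ea k i j (m + n) = 0 := fun i j h => dif_neg h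
  rw [hs, hb, lc_sub (fun z : Q.BIdx => Q.ea k z.1.1 z.1.2 (m + n)),
    Q.lc_bE k (fun i j => Q.ea k i j (m + n)) h0, Q.lc_bE k (fun i j => Q.ea k i j (m + n)) h0]
  refine LinearMap.ext fun v => ?_
  have := (Q.colModes k).EE x.1.1 x.1.2 y.1.1 y.1.2 x.2 y.2 m n v
  simp only [LinearMap.sub_apply, Module.End.mul_apply, LinearMap.smul_apply,
    LinearMap.add_apply, Module.End.one_apply]
  rw [this]
  change _ = _ + (if m + n = 0 then (m : ℂ) * colForm col (Q.zeta k) x.1.1 x.1.2 y.1.1 y.1.2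
    else 0) • v
  module

theorem ea_vac (k : ℂ) (i j : Q.Box) (n : ℤ) (hn : 0 ≤ n) : Q.ea k i j n (Q.aTable k).vac = 0 := by
  unfold ea
  split_ifs
  · exact (Q.aTable k).mode_vac _ n hn
  · rfl

theorem psi_vac (k : ℂ) (i j : Q.Box) (n : ℤ) (hn : 0 ≤ n) :
    Q.psi k i j n (Q.aTable k).vac = 0 := by
  unfold psi
  split_ifs
  · exact (Q.aTable k).mode_vac _ n hn
  · rfl

/-- The inclusion `V^κ(𝔟) → V^κ̃(𝔞)`. -/
noncomputable def incl (k : ℂ) : Q.Vb k →ₗ[ℂ] Q.Va k :=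
  (Q.bTable k).lift _ (Q.incl_isRep k) (Q.aTable k).vac
    (fun x n hn => Q.ea_vac k x.1.1 x.1.2 n hn)

theorem d0_isRep (k : ℂ) : (Q.bTable k).IsRep (fun x n =>
    LieSuperTable.tri (Q.ea k x.1.1 x.1.2 n) (Q.ea k x.1.1 x.1.2 n) (Q.dField k x.1.1 x.1.2 n)) := by
  refine (Q.bTable k).isRep_tri (Q.incl_isRep k) (Q.incl_isRep k)
    (fun x n => Q.dField k x.1.1 x.1.2 n) ?_
  intro x y m n v
  have hs : (Q.bTable k).sign x y = 1 := rfl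
  have hb : (Q.bTable k).bracket x y
    = dl x.1.2 y.1.1 • Q.bE x.1.1 y.1.2 - dl x.1.1 y.1.2 • Q.bE y.1.1 x.1.2 := rfl
  have h0 : ∀ i j, ¬ col j ≤ col i → Q.dField k i j (m + n) v = 0 := by
    intro i j h
    have h' : ¬ col j < col i := by omega
    rw [dField_apply, (Q.colModes k).P_zero i j h']
    unfold ColModes.S1 ColModes.S2
    rw [Finset.sum_eq_zero fun r _ => (Q.colModes k).cut1_zero r j i r (by omega) _ _ _,
      Finset.sum_eq_zero fun r _ => (Q.colModes k).cut2_zero r j i r (by omega) _ _ _]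
    rw [Finset.sum_eq_zero, Finset.sum_eq_zero]
    · simp
    · intro r _
      unfold hatInd
      split_ifs with hr
      · rw [(Q.colModes k).P_zero i r (by omega), smul_zero]
      · rw [zero_smul]
    · intro r _
      unfold hatInd
      split_ifs with hr
      · rw [(Q.colModes k).P_zero r j (by omega), smul_zero]
      · rw [zero_smul]
  rw [hs, hb, lc_sub (fun z : Q.BIdx => Q.dField k z.1.1 z.1.2 (m + n) v),
    Q.lc_bE k (fun i j => Q.dField k i j (m + n) v) h0,
    Q.lc_bE k (fun i j => Q.dField k i j (m + n) v) h0, one_smul]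
  exact Q.dField_leibniz k _ _ _ _ x.2 y.2 m n v

theorem dField_vac (k : ℂ) (i j : Q.Box) (n : ℤ) (hn : 0 ≤ n) :
    Q.dField k i j n (Q.aTable k).vac = 0 := by
  have hc : ∀ {A B : ℤ → Module.End ℂ (Q.Va k)}, (∀ n, 0 ≤ n → A n (Q.aTable k).vac = 0) →
      (∀ n, 0 ≤ n → B n (Q.aTable k).vac = 0) → cut A B 0 n (Q.aTable k).vac = 0 := by
    intro A B hA hB
    unfold cut cutTerm
    refine finsum_eq_zero_of_forall_eq_zero fun l => ?_
    split_ifs with h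
    · rw [hB _ (by omega), map_zero]
    · rw [hA _ (by omega), map_zero]
  rw [dField_apply]
  unfold ColModes.S1 ColModes.S2
  rw [Finset.sum_eq_zero fun r _ => hc (Q.ea_vac k r j) (Q.psi_vac k i r),
    Finset.sum_eq_zero fun r _ => hc (Q.psi_vac k r j) (Q.ea_vac k i r)]
  have h1 : ((n : ℂ) * Q.zeta k (col i)) • Q.psi k i j (n - 1) (Q.aTable k).vac = 0 := by
    rcases hn.eq_or_lt with rfl | h
    · simp
    · rw [Q.psi_vac k i j (n - 1) (by omega), smul_zero]
  rw [h1]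
  simp [Q.psi_vac k _ _ n hn]

/-- The odd differential `d₀ : V^κ(𝔟) → V^κ̃(𝔞)`: the linear map with `d₀|0⟩ = 0` and
`[d₀, x_{(n)}] = (d₀ x)_{(n)}` for `x = e_{i,j}[-1]` and all `n`, where `d₀ e_{i,j}[-1]` is the state
with field `dField k i j`; see `d0_vac`, `d0_mode`, `d0_gen`, `d0_transl` below. -/
noncomputable def d0 (k : ℂ) : Q.Vb k →ₗ[ℂ] Q.Va k :=
  LinearMap.snd ℂ (Q.Va k) (Q.Va k) ∘ₗ
    (Q.bTable k).lift _ (Q.d0_isRep k) ((Q.aTable k).vac, 0) (fun x n hn => by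
      rw [LieSuperTable.tri_apply, Q.ea_vac k _ _ n hn, Q.dField_vac k _ _ n hn]
      simp)

theorem d0_vac (k : ℂ) : Q.d0 k (Q.bTable k).vac = 0 := by
  unfold d0
  rw [LinearMap.comp_apply, LieSuperTable.lift_vac]; rfl

theorem incl_vac (k : ℂ) : Q.incl k (Q.bTable k).vac = (Q.aTable k).vac :=
  LieSuperTable.lift_vac _ _ _ _ _

theorem eb_of_le (k : ℂ) {i j : Q.Box} (h : col j ≤ col i) (n : ℤ) :
    Q.eb k i j n = (Q.bTable k).mode ⟨(i, j), h⟩ n := dif_pos h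

theorem incl_mode (k : ℂ) (i j : Q.Box) (n : ℤ) (v : Q.Vb k) :
    Q.incl k (Q.eb k i j n v) = Q.ea k i j n (Q.incl k v) := by
  by_cases h : col j ≤ col i
  · rw [eb_of_le Q k h]
    exact LieSuperTable.lift_mode _ _ _ _ _ _ _ _
  · rw [(Q.colModes k).E_zero i j h]
    unfold eb
    rw [dif_neg h, LinearMap.zero_apply, map_zero]

/-- The commutator of `d₀` with the modes of `e_{i,j}[-1]`. -/
theorem d0_mode (k : ℂ) (i j : Q.Box) (h : col j ≤ col i) (n : ℤ) (v : Q.Vb k) :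
    Q.d0 k (Q.eb k i j n v)
      = Q.dField k i j n (Q.incl k v) + Q.ea k i j n (Q.d0 k v) := by
  have h0 : ∀ x n, 0 ≤ n → (fun (x : Q.BIdx) n => LieSuperTable.tri (Q.ea k x.1.1 x.1.2 n)
      (Q.ea k x.1.1 x.1.2 n) (Q.dField k x.1.1 x.1.2 n)) x n ((Q.aTable k).vac, 0) = 0 := by
    intro x n hn
    simp only
    rw [LieSuperTable.tri_apply, Q.ea_vac k _ _ n hn, Q.dField_vac k _ _ n hn]
    simp
  have h1 : ∀ v, ((Q.bTable k).lift _ (Q.d0_isRep k) ((Q.aTable k).vac, 0) h0 v).1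
      = Q.incl k v := by
    intro v
    induction v using (Q.bTable k).va_induction with
    | h0 => rw [map_zero, map_zero]; rfl
    | hvac => rw [LieSuperTable.lift_vac, incl_vac]
    | ha v w h1 h2 => rw [map_add, map_add, Prod.fst_add, h1, h2]
    | hs c v h => rw [map_smul, map_smul, Prod.smul_fst, h]
    | hm x n v h =>
      rw [LieSuperTable.lift_mode, LieSuperTable.tri_apply, h]
      have := Q.incl_mode k x.1.1 x.1.2 n v
      rw [eb_of_le Q k x.2] at this
      exact this.symm
  rw [← h1, eb_of_le Q k h]
  unfold d0
  rw [LinearMap.comp_apply, LieSuperTable.lift_mode, LieSuperTable.tri_apply]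
  rfl

/-- The value of `d₀` on the generator `e_{i,j}[-1]`. -/
theorem d0_gen (k : ℂ) (i j : Q.Box) (h : col j ≤ col i) :
    Q.d0 k (Q.eb k i j (-1) (Q.bTable k).vac)
      = (∑ r : Q.Box with col j ≤ col r ∧ col r < col i,
          Q.ea k r j (-1) (Q.psi k i r (-1) (Q.aTable k).vac))
        - (∑ r : Q.Box with col j < col r ∧ col r ≤ col i,
          Q.psi k r j (-1) (Q.ea k i r (-1) (Q.aTable k).vac))
        + (if col j < col i then Q.zeta k (col i) • Q.psi k i j (-2) (Q.aTable k).vac else 0)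
        + (∑ r : Q.Box with col r = col i + 1 ∧ row r = row i,
            Q.psi k r j (-1) (Q.aTable k).vac)
        - (∑ r : Q.Box with col r + 1 = col j ∧ row r = row j,
            Q.psi k i r (-1) (Q.aTable k).vac) := by
  rw [d0_mode Q k i j h, d0_vac, map_zero, add_zero, incl_vac]
  unfold dField
  simp only [LinearMap.sub_apply, LinearMap.add_apply, LinearMap.sum_apply, nop_apply]
  rw [Finset.sum_congr rfl fun r _ => cut_vac _ (Q.ea_vac k r j) (Q.psi_vac k i r),
    Finset.sum_congr rfl fun r _ => cut_vac _ (Q.psi_vac k r j) (Q.ea_vac k i r)]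
  congr 3
  split_ifs
  · simp
  · rfl

theorem dField_transl (k : ℂ) (i j : Q.Box) (m : ℤ) (v : Q.Va k) :
    (Q.aTable k).transl (Q.dField k i j m v)
      = Q.dField k i j m ((Q.aTable k).transl v) - (m : ℂ) • Q.dField k i j (m - 1) v := by
  have tE : ∀ i j n v, (Q.aTable k).transl (Q.ea k i j n v)
      = Q.ea k i j n ((Q.aTable k).transl v) - (n : ℂ) • Q.ea k i j (n - 1) v := by
    intro i j n v
    unfold ea
    split_ifs
    · exact (Q.aTable k).transl_mode _ _ _
    · simp
  have tP : ∀ i j n v, (Q.aTable k).transl (Q.psi k i j n v)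
      = Q.psi k i j n ((Q.aTable k).transl v) - (n : ℂ) • Q.psi k i j (n - 1) v := by
    intro i j n v
    unfold psi
    split_ifs
    · exact (Q.aTable k).transl_mode _ _ _
    · simp
  have t1 := fun r => transl_cut (Q.ea_trunc k r j) (Q.psi_trunc k i r) (Q.aTable k).transl
    (tE r j) (tP i r) m v
  have t2 := fun r => transl_cut (Q.psi_trunc k r j) (Q.ea_trunc k i r) (Q.aTable k).transl
    (tP r j) (tE i r) m v
  simp only [dField_apply]
  unfold ColModes.S1 ColModes.S2
  simp only [map_add, map_sub, map_sum, map_smul, tP, t1, t2, Finset.sum_sub_distrib, smul_sub,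
    smul_comm (_ : ℂ) (m : ℂ), ← Finset.smul_sum]
  push_cast
  module

/-- The differential commutes with the translation operators. -/
theorem d0_transl (k : ℂ) (v : Q.Vb k) :
    Q.d0 k ((Q.bTable k).transl v) = (Q.aTable k).transl (Q.d0 k v) := by
  have ti : ∀ v, Q.incl k ((Q.bTable k).transl v) = (Q.aTable k).transl (Q.incl k v) := by
    intro v
    induction v using (Q.bTable k).va_induction with
    | h0 => simp
    | hvac => rw [LieSuperTable.transl_vac, incl_vac, LieSuperTable.transl_vac, map_zero]
    | ha v w h1 h2 => simp only [map_add, h1, h2]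
    | hs c v h => simp only [map_smul, h]
    | hm x n v h =>
      have e : ∀ n w, Q.incl k ((Q.bTable k).mode x n w)
          = (Q.aTable k).mode (Sum.inl x) n (Q.incl k w) := by
        intro n w
        have := Q.incl_mode k x.1.1 x.1.2 n w
        unfold eb ea at this
        rw [dif_pos x.2, dif_pos x.2] at this
        exact this
      rw [LieSuperTable.transl_mode, e, LieSuperTable.transl_mode, map_sub, map_smul, e, e, h]
  induction v using (Q.bTable k).va_induction with
  | h0 => simp
  | hvac => rw [LieSuperTable.transl_vac, d0_vac, map_zero, map_zero]
  | ha v w h1 h2 => simp only [map_add, h1, h2]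
  | hs c v h => simp only [map_smul, h]
  | hm x n v h =>
    have e : ∀ n w, Q.d0 k ((Q.bTable k).mode x n w)
        = Q.dField k x.1.1 x.1.2 n (Q.incl k w)
          + (Q.aTable k).mode (Sum.inl x) n (Q.d0 k w) := by
      intro n w
      have := Q.d0_mode k x.1.1 x.1.2 x.2 n w
      unfold eb ea at this
      rw [dif_pos x.2, dif_pos x.2] at this
      exact this
    rw [LieSuperTable.transl_mode, map_sub, map_smul, e, e, e, map_add, dField_transl,
      LieSuperTable.transl_mode, h, ti]
    module

/-- The `W`-algebra `W^k(gl(N), f) = {y ∈ V^κ(𝔟) | d₀ y = 0}`. -/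
noncomputable def wAlgebra (k : ℂ) : Submodule ℂ (Q.Vb k) := LinearMap.ker (Q.d0 k)

/-- The element `W^{(1)}_{p,q}` of `V^κ(𝔟)`. -/
noncomputable def W1 (k : ℂ) (p q : ℕ) : Q.Vb k :=
  ∑ x : Q.Box × Q.Box with row x.1 = p ∧ row x.2 = q ∧ col x.1 = col x.2,
    Q.eb k x.1 x.2 (-1) (Q.bTable k).vac

/-- The element `W^{(2)}_{p,q}` of `V^κ(𝔟)`, for `q` in the `a`-th range of rows. In the quadratic
terms the variable `y = (i, j, u, v)` runs over quadruples of boxes, and the product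
`e_{u,j}[-1] e_{i,v}[-1]` is `(e_{u,j}[-1])_{(-1)} e_{i,v}[-1]`. -/
noncomputable def W2 (k : ℂ) (a p q : ℕ) : Q.Vb k :=
  (∑ x : Q.Box × Q.Box with row x.1 = p ∧ row x.2 = q ∧ col x.1 = col x.2 + 1,
      Q.eb k x.1 x.2 (-1) (Q.bTable k).vac)
    - (∑ x : Q.Box × Q.Box with row x.1 = p ∧ row x.2 = q ∧ col x.1 = col x.2,
      Q.gamma k (col x.1) • Q.eb k x.1 x.2 (-2) (Q.bTable k).vac)
    + (∑ y : Q.Box × Q.Box × Q.Box × Q.Box with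
        (row y.1 = p ∧ row y.2.1 = q) ∧
        (col y.2.2.1 = col y.2.1 ∧ col y.2.1 < col y.1 ∧ col y.1 = col y.2.2.2) ∧
        (row y.2.2.1 = row y.2.2.2 ∧ Q.q 1 - Q.q a < row y.2.2.1),
      Q.eb k y.2.2.1 y.2.1 (-1) (Q.eb k y.1 y.2.2.2 (-1) (Q.bTable k).vac))
    - (∑ y : Q.Box × Q.Box × Q.Box × Q.Box with
        (row y.1 = p ∧ row y.2.1 = q) ∧
        (col y.2.2.1 = col y.2.1 ∧ col y.1 ≤ col y.2.1 ∧ col y.1 = col y.2.2.2) ∧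
        (row y.2.2.1 = row y.2.2.2 ∧ row y.2.2.1 ≤ Q.q 1 - Q.q a),
      Q.eb k y.2.2.1 y.2.1 (-1) (Q.eb k y.1 y.2.2.2 (-1) (Q.bTable k).vac))

end Pyramid

end WAlgebraTypeA

/-! Column heights decrease from left to right, so the boxes of each row fill the columns 1, 2, ...
without gaps. Write positions as (column, row) and set `e` or `ψ` equal to zero when one of its
positions is not a box. Then `d₀` acts as a difference operator. For `col i = col j = c` all
quadratic and derivative terms of `d₀ e_{i,j}` are absent, and what remains is `F c - F (c - 1)`
with `F c = ψ_{(c+1,p),(c,q)}` (`d0_eb_of_col_eq`). The sum over `c` telescopes to zero, since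
columns 0 and `width + 1` are empty; this settles `W1`.

For `W2`, the linear terms with `col i = col j + 1` have telescoping linear images, so their
differential (`d0_sum_col_succ`) consists of the terms `ζ_{c+1} ψ_{(c+1,p),(c,q)}[-2]` and, for
every row `x` and column `c`, of `ePsi x c c - psiE x c (c+1)`. Summation by parts with `γ_c -
γ_{c+1} = ζ_{c+1}` shows that the `γ` terms have exactly the `ζ` terms as differential
(`d0_sum_gamma`), and they enter with a minus sign. For a quadratic term with `row u = row v = x`,
`c = col j` and `d = col i`, the differential is a discrete divergence: the `c`-difference of `psiE
x c d` plus the `d`-difference of `ePsi x c d`. Summed over `c < d` it leaves the diagonal `∑ (psiE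
x c (c+1) - ePsi x c c)`; summed over `d ≤ c` it leaves the negative of this (`sum_telescope_lt`,
`sum_telescope_ge`). With the signs of `W2`, long and short rows therefore contribute the same
expression, each row once, and it cancels the quadratic part found before. The products match in the
same order, so no commutators arise.

It remains to pass from sums over boxes to sums over all positions. Row `p` is at most as long as
row `q`; rows beyond `q₁ - q_a` are at least as long as row `q`, and the other rows at most as long
(`mem_boxes_of_range`, `mem_boxes_of_row_le`). These comparisons make every added term zero, over `c
< d` for the long rows and over `d ≤ c` for the short ones (`d0_sum_long`, `d0_sum_short`). -/

namespace WAlgebraTypeA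

/-! ### Telescoping sums in one and two indices. -/

section Telescoping

variable {M : Type} [AddCommGroup M]

/-- Truncated subtraction makes the term at `c = 0` vanish, so column 0 can be included without
harm. Then `f 0 = 0` removes the lower boundary value. -/
theorem sum_range_sub_pred (f : ℕ → M) (h0 : f 0 = 0) (n : ℕ) :
    ∑ c ∈ Finset.range (n + 1), (f c - f (c - 1)) = f n := by
  rw [Finset.sum_range_succ']
  simp only [Nat.add_sub_cancel, Finset.sum_range_sub, h0, Nat.zero_sub, sub_zero, add_zero]

theorem sum_range_sub_pred_le (f : ℕ → M) (h0 : f 0 = 0) {c n : ℕ} (h : c ≤ n) :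
    ∑ d ∈ Finset.range (n + 1), (if d ≤ c then f d - f (d - 1) else 0) = f c := by
  rw [← Finset.sum_filter, ← sum_range_sub_pred f h0 c]
  refine Finset.sum_congr ?_ fun _ _ => rfl
  ext d
  simp only [Finset.mem_filter, Finset.mem_range]
  omega

theorem sum_range_sub_pred_lt (f : ℕ → M) (h0 : f 0 = 0) {d n : ℕ} (h : d ≤ n) :
    ∑ c ∈ Finset.range (n + 1), (if c < d then f c - f (c - 1) else 0) = f (d - 1) := by
  rcases d with _ | d
  · simp [h0]
  · rw [← sum_range_sub_pred_le f h0 (show d + 1 - 1 ≤ n by omega)]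
    refine Finset.sum_congr rfl fun c _ => ?_
    simp only [Nat.lt_succ_iff, Nat.add_sub_cancel]

theorem sum_range_sub_pred_gt (f : ℕ → M) (h0 : f 0 = 0) {c n : ℕ} (h : c ≤ n) :
    ∑ d ∈ Finset.range (n + 1), (if c < d then f d - f (d - 1) else 0) = f n - f c := by
  rw [eq_sub_iff_add_eq, ← sum_range_sub_pred_le f h0 h, ← Finset.sum_add_distrib,
    ← sum_range_sub_pred f h0 n]
  refine Finset.sum_congr rfl fun d _ => ?_
  split_ifs <;> first | omega | simp

theorem sum_range_sub_pred_ge (f : ℕ → M) (h0 : f 0 = 0) {d n : ℕ} (h : d ≤ n) :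
    ∑ c ∈ Finset.range (n + 1), (if d ≤ c then f c - f (c - 1) else 0) = f n - f (d - 1) := by
  rw [eq_sub_iff_add_eq, ← sum_range_sub_pred_lt f h0 h, ← Finset.sum_add_distrib,
    ← sum_range_sub_pred f h0 n]
  refine Finset.sum_congr rfl fun d _ => ?_
  split_ifs <;> first | omega | simp

/-- The shift `d = c + 1` leaves one unmatched term on each side: `A 0 0` on the left (where `0 - 1
= 0`) and `A n (n + 1)` on the right. Both vanish. -/
theorem sum_pred_eq_sum_succ (A : ℕ → ℕ → M) (n : ℕ) (h0 : ∀ d, A 0 d = 0)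
    (hn : ∀ d, A n d = 0) : ∑ d ∈ Finset.range (n + 1), A (d - 1) d
      = ∑ c ∈ Finset.range (n + 1), A c (c + 1) := by
  rw [Finset.sum_range_succ', Finset.sum_range_succ (fun c => A c (c + 1))]
  simp [h0, hn]

/-- Telescoping over the region `c < d`. -/
theorem sum_telescope_lt (A B : ℕ → ℕ → M) (n : ℕ) (hA0 : ∀ d, A 0 d = 0) (hAn : ∀ d, A n d = 0)
    (hB0 : ∀ c, B c 0 = 0) (hBn : ∀ c, B c n = 0) :
    ∑ c ∈ Finset.range (n + 1), ∑ d ∈ Finset.range (n + 1),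
      (if c < d then (A c d - A (c - 1) d) + (B c d - B c (d - 1)) else 0)
    = ∑ c ∈ Finset.range (n + 1), (A c (c + 1) - B c c) := by
  have e : ∀ c d, (if c < d then (A c d - A (c - 1) d) + (B c d - B c (d - 1)) else 0)
      = (if c < d then A c d - A (c - 1) d else 0) + (if c < d then B c d - B c (d - 1) else 0) := by
    intro c d; split_ifs <;> simp
  simp only [e, Finset.sum_add_distrib, Finset.sum_sub_distrib]
  -- The `A` part telescopes in `c` for fixed `d`, so its order of summation is exchanged; the `B`
  -- part telescopes in `d` and is already in order.
  rw [Finset.sum_comm]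
  rw [Finset.sum_congr rfl fun d hd => sum_range_sub_pred_lt (fun c => A c d) (hA0 d)
      (Nat.lt_succ_iff.1 (Finset.mem_range.1 hd)),
    Finset.sum_congr rfl fun c hc => sum_range_sub_pred_gt (B c) (hB0 c)
      (Nat.lt_succ_iff.1 (Finset.mem_range.1 hc)), sum_pred_eq_sum_succ A n hA0 hAn]
  simp [hBn, sub_eq_add_neg]

/-- Telescoping over the region `d ≤ c`. -/
theorem sum_telescope_ge (A B : ℕ → ℕ → M) (n : ℕ) (hA0 : ∀ d, A 0 d = 0) (hAn : ∀ d, A n d = 0)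
    (hB0 : ∀ c, B c 0 = 0) :
    ∑ c ∈ Finset.range (n + 1), ∑ d ∈ Finset.range (n + 1),
      (if d ≤ c then (A c d - A (c - 1) d) + (B c d - B c (d - 1)) else 0)
    = -∑ c ∈ Finset.range (n + 1), (A c (c + 1) - B c c) := by
  have e : ∀ c d, (if d ≤ c then (A c d - A (c - 1) d) + (B c d - B c (d - 1)) else 0)
      = (if d ≤ c then A c d - A (c - 1) d else 0) + (if d ≤ c then B c d - B c (d - 1) else 0) := by
    intro c d; split_ifs <;> simp
  simp only [e, Finset.sum_add_distrib, Finset.sum_sub_distrib]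
  rw [Finset.sum_comm]
  rw [Finset.sum_congr rfl fun d hd => sum_range_sub_pred_ge (fun c => A c d) (hA0 d)
      (Nat.lt_succ_iff.1 (Finset.mem_range.1 hd)),
    Finset.sum_congr rfl fun c hc => sum_range_sub_pred_le (B c) (hB0 c)
      (Nat.lt_succ_iff.1 (Finset.mem_range.1 hc))]
  simp only [hAn, zero_sub, Finset.sum_neg_distrib]
  rw [sum_pred_eq_sum_succ A n hA0 hAn]
  abel

end Telescoping

namespace Pyramid

variable (Q : Pyramid)

/-! ### Shape of the pyramid: lengths of rows and heights of columns. -/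

section Boxes

theorem mem_boxes {c x : ℕ} : (c, x) ∈ Q.boxes ↔
    (1 ≤ c ∧ c ≤ Q.width) ∧ (1 ≤ x ∧ x ≤ Q.q 1) ∧ Q.q 1 - Q.height c < x := by
  simp [boxes, and_assoc]

theorem block_mono {c d : ℕ} (h : c ≤ d) : Q.block c ≤ Q.block d := by
  unfold block
  gcongr

theorem q_antitone {u v : ℕ} (h1 : 1 ≤ u) (h : u ≤ v) (hv : v ≤ Q.s + 1) : Q.q v ≤ Q.q u := by
  induction v, h using Nat.le_induction with
  | base => exact le_rfl
  | succ n hn ih => exact (Q.q_anti n (h1.trans hn) (by omega)).le.trans (ih (by omega))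

theorem height_antitone {c d : ℕ} (h : c ≤ d) : Q.height d ≤ Q.height c :=
  Q.q_antitone (Q.block_mem c).1 (Q.block_mono h) (Q.block_mem d).2

/-- Rows are left-justified, because heights decrease with the column. -/
theorem mem_boxes_of_col_le {c d x : ℕ} (hd : (d, x) ∈ Q.boxes) (h1 : 1 ≤ c) (h : c ≤ d) :
    (c, x) ∈ Q.boxes := by
  rw [mem_boxes] at hd ⊢
  have := Q.height_antitone h
  omega

/-- All columns end at the common row `q₁`, so rows get longer as their index grows. -/
theorem mem_boxes_of_row_le {c x y : ℕ} (hx : (c, x) ∈ Q.boxes) (h : x ≤ y) (hy : y ≤ Q.q 1) :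
    (c, y) ∈ Q.boxes := by
  rw [mem_boxes] at hx ⊢
  omega

/-- A row up to the end of the `a`-th range is at most as long as a row beyond the start of this
range. -/
theorem mem_boxes_of_range {a c x y : ℕ} (ha : 1 ≤ a) (has : a ≤ Q.s) (hx : (c, x) ∈ Q.boxes)
    (hxa : x ≤ Q.q 1 - Q.q (a + 1)) (hya : Q.q 1 - Q.q a < y) (hy : y ≤ Q.q 1) :
    (c, y) ∈ Q.boxes := by
  rw [mem_boxes] at hx ⊢
  -- A column of a later block has height at most `q_{a+1}`, so it meets only rows beyond `q₁ -
  -- q_{a+1}` and cannot contain `x`.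
  have hb : Q.block c ≤ a := by
    by_contra h
    have : Q.height c ≤ Q.q (a + 1) :=
      Q.q_antitone (by omega) (by omega) (Q.block_mem c).2
    omega
  have : Q.q a ≤ Q.height c := Q.q_antitone (Q.block_mem c).1 hb (by omega)
  omega

theorem one_le_col (i : Q.Box) : 1 ≤ col i := ((Q.mem_boxes).1 i.2).1.1

theorem col_le_width (i : Q.Box) : col i ≤ Q.width := ((Q.mem_boxes).1 i.2).1.2

theorem row_le (i : Q.Box) : row i ≤ Q.q 1 := ((Q.mem_boxes).1 i.2).2.1.2

theorem box_ext {i j : Q.Box} (hc : col i = col j) (hr : row i = row j) : i = j :=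
  Subtype.ext (Prod.ext hc hr)

theorem gamma_eq (k : ℂ) {c : ℕ} (h : c + 1 ≤ Q.width) :
    Q.gamma k c = Q.zeta k (c + 1) + Q.gamma k (c + 1) := by
  unfold gamma
  rw [← Finset.insert_Icc_add_one_left_eq_Icc h, Finset.sum_insert (by simp)]

end Boxes

/-! ### Extension by zero outside the pyramid. -/

section Extension

variable {M : Type} [Zero M]

/-- The extension by zero of a function of two boxes to all positions `(c, x)`, `(d, y)`. -/
def ext2 (f : Q.Box → Q.Box → M) (c x d y : ℕ) : M :=
  if h : (c, x) ∈ Q.boxes ∧ (d, y) ∈ Q.boxes then f ⟨(c, x), h.1⟩ ⟨(d, y), h.2⟩ else 0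

theorem ext2_box (f : Q.Box → Q.Box → M) (i j : Q.Box) :
    Q.ext2 f (col i) (row i) (col j) (row j) = f i j := dif_pos ⟨i.2, j.2⟩

theorem ext2_left_zero (f : Q.Box → Q.Box → M) {c x : ℕ} (h : (c, x) ∉ Q.boxes) (d y : ℕ) :
    Q.ext2 f c x d y = 0 := dif_neg fun h' => h h'.1

theorem ext2_right_zero (f : Q.Box → Q.Box → M) {d y : ℕ} (h : (d, y) ∉ Q.boxes) (c x : ℕ) :
    Q.ext2 f c x d y = 0 := dif_neg fun h' => h h'.2

theorem zero_notMem (x : ℕ) : (0, x) ∉ Q.boxes := by simp [mem_boxes]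

theorem width_succ_notMem (x : ℕ) : (Q.width + 1, x) ∉ Q.boxes := by
  rw [mem_boxes]; omega

end Extension

/-! ### Sums over boxes rewritten as sums over rows and columns. -/

section Sums

variable {M : Type} [AddCommGroup M]

theorem sum_col_eq (c : ℕ) (f : Q.Box → M) (g : ℕ → M)
    (hg : ∀ r, col r = c → f r = g (row r)) (h0 : ∀ x, (c, x) ∉ Q.boxes → g x = 0) :
    ∑ r : Q.Box with col r = c, f r = ∑ x ∈ Finset.range (Q.q 1 + 1), g x := by
  refine Finset.sum_of_injOn row ?_ ?_ ?_ ?_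
  · intro r hr t ht h
    simp only [Finset.coe_filter, Finset.mem_univ, true_and, Set.mem_ofPred_eq] at hr ht
    exact Q.box_ext (hr.trans ht.symm) h
  · intro r _
    have := Q.row_le r
    simpa using Nat.lt_succ_of_le this
  · intro x _ hx
    exact h0 x fun h => hx ⟨⟨(c, x), h⟩,
      Finset.mem_coe.2 (Finset.mem_filter.2 ⟨Finset.mem_univ _, rfl⟩), rfl⟩
  · intro r hr
    exact hg r (Finset.mem_filter.1 hr).2

/-- A position carries at most one box. The case of no box is how an omitted `î` or `j̃` becomes a
term extended by zero. -/
theorem sum_single_box (c x : ℕ) (f : Q.Box → M) (m : M) (hf : ∀ r, col r = c → row r = x → f r = m)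
    (h0 : (c, x) ∉ Q.boxes → m = 0) : ∑ r : Q.Box with col r = c ∧ row r = x, f r = m := by
  by_cases h : (c, x) ∈ Q.boxes
  · rw [Finset.sum_eq_single_of_mem ⟨(c, x), h⟩
      (Finset.mem_filter.2 ⟨Finset.mem_univ _, rfl, rfl⟩)]
    · exact hf _ rfl rfl
    · intro r hr hne
      rw [Finset.mem_filter] at hr
      exact absurd (Q.box_ext hr.2.1 hr.2.2) hne
  · rw [h0 h]
    refine Finset.sum_eq_zero fun r hr => absurd r.2 ?_
    rw [Finset.mem_filter] at hr
    have : r.1 = (c, x) := Prod.ext hr.2.1 hr.2.2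
    rwa [this]

/-- With both rows and the column shift `m` fixed, the pair is determined by the column of its
second box. The hypothesis `h0` is the place where the shape of the pyramid enters later: extending
the sum to all columns must cost nothing. -/
theorem sum_pairs (m p q : ℕ) (f : Q.Box × Q.Box → M) (g : ℕ → M)
    (hg : ∀ i j : Q.Box, row i = p → row j = q → col i = col j + m → f (i, j) = g (col j))
    (h0 : ∀ c, ¬ ((c + m, p) ∈ Q.boxes ∧ (c, q) ∈ Q.boxes) → g c = 0) :
    ∑ x : Q.Box × Q.Box with row x.1 = p ∧ row x.2 = q ∧ col x.1 = col x.2 + m, f x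
      = ∑ c ∈ Finset.range (Q.width + 1), g c := by
  refine Finset.sum_of_injOn (fun x => col x.2) ?_ ?_ ?_ ?_
  · rintro ⟨i, j⟩ h1 ⟨i', j'⟩ h2 h
    simp only [Finset.coe_filter, Finset.mem_univ, true_and, Set.mem_ofPred_eq] at h1 h2 h
    have e1 : j = j' := Q.box_ext h (by omega)
    have e2 : i = i' := Q.box_ext (by omega) (by omega)
    rw [e1, e2]
  · intro x _
    have := Q.col_le_width x.2
    simpa using Nat.lt_succ_of_le this
  · intro c _ hx
    exact h0 c fun h => hx ⟨(⟨(c + m, p), h.1⟩, ⟨(c, q), h.2⟩),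
      Finset.mem_coe.2 (Finset.mem_filter.2 ⟨Finset.mem_univ _, rfl, rfl, rfl⟩), rfl⟩
  · rintro ⟨i, j⟩ h
    rw [Finset.mem_filter] at h
    exact hg i j h.2.1 h.2.2.1 h.2.2.2

theorem sum_pairs_of_col_eq (p q : ℕ) (f : Q.Box × Q.Box → M) (g : ℕ → M)
    (hg : ∀ i j : Q.Box, row i = p → row j = q → col i = col j → f (i, j) = g (col j))
    (h0 : ∀ c, ¬ ((c, p) ∈ Q.boxes ∧ (c, q) ∈ Q.boxes) → g c = 0) :
    ∑ x : Q.Box × Q.Box with row x.1 = p ∧ row x.2 = q ∧ col x.1 = col x.2, f x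
      = ∑ c ∈ Finset.range (Q.width + 1), g c :=
  Q.sum_pairs 0 p q f g hg h0

/-- A quadruple has three degrees of freedom: the common row `x` of `u` and `v`, the column `c` of
`j` and `u`, the column `d` of `i` and `v`. The relation `R` stands for `c < d` or `d ≤ c`, and `S`
for the long or the short rows. -/
theorem sum_quadruples (p q : ℕ) (R : ℕ → ℕ → Prop) [DecidableRel R] (S : ℕ → Prop)
    [DecidablePred S] (f : Q.Box × Q.Box × Q.Box × Q.Box → M) (g : ℕ → ℕ → ℕ → M)
    (hg : ∀ i j u v : Q.Box, row i = p → row j = q → col u = col j → R (col j) (col i) →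
      col i = col v → row u = row v → S (row u) → f (i, j, u, v) = g (row u) (col j) (col i))
    (h0 : ∀ x c d, R c d → S x → x ≤ Q.q 1 → ¬ ((d, p) ∈ Q.boxes ∧ (c, q) ∈ Q.boxes ∧
      (c, x) ∈ Q.boxes ∧ (d, x) ∈ Q.boxes) → g x c d = 0) :
    ∑ y : Q.Box × Q.Box × Q.Box × Q.Box with
        (row y.1 = p ∧ row y.2.1 = q) ∧
        (col y.2.2.1 = col y.2.1 ∧ R (col y.2.1) (col y.1) ∧ col y.1 = col y.2.2.2) ∧
        (row y.2.2.1 = row y.2.2.2 ∧ S (row y.2.2.1)), f y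
      = ∑ x ∈ Finset.range (Q.q 1 + 1) with S x, ∑ c ∈ Finset.range (Q.width + 1),
          ∑ d ∈ Finset.range (Q.width + 1), if R c d then g x c d else 0 := by
  simp only [← Finset.sum_product']
  refine Finset.sum_of_injOn (fun y => (row y.2.2.1, col y.2.1, col y.1)) ?_ ?_ ?_ ?_
  · rintro ⟨i, j, u, v⟩ h1 ⟨i', j', u', v'⟩ h2 h
    simp only [Finset.coe_filter, Finset.mem_univ, true_and, Set.mem_ofPred_eq, Prod.mk.injEq]
      at h1 h2 h
    have e1 : i = i' := Q.box_ext (by omega) (by omega)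
    have e2 : j = j' := Q.box_ext (by omega) (by omega)
    have e3 : u = u' := Q.box_ext (by omega) (by omega)
    have e4 : v = v' := Q.box_ext (by omega) (by omega)
    rw [e1, e2, e3, e4]
  · rintro ⟨i, j, u, v⟩ h
    have h1 := Q.col_le_width j
    have h2 := Q.col_le_width i
    have h3 := Q.row_le u
    simp only [Finset.coe_filter, Finset.mem_univ, true_and, Set.mem_ofPred_eq] at h
    simp only [Finset.coe_product, Set.mem_prod, Finset.mem_coe, Finset.mem_filter,
      Finset.mem_range, Nat.lt_succ_iff]
    exact ⟨⟨h3, h.2.2.2⟩, h1, h2⟩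
  · rintro ⟨x, c, d⟩ hm hx
    simp only [Finset.mem_product, Finset.mem_filter, Finset.mem_range, Nat.lt_succ_iff] at hm
    dsimp only
    split_ifs with hR
    · refine h0 x c d hR hm.1.2 hm.1.1 fun h => hx ?_
      refine ⟨(⟨(d, p), h.1⟩, ⟨(c, q), h.2.1⟩, ⟨(c, x), h.2.2.1⟩, ⟨(d, x), h.2.2.2⟩), ?_, rfl⟩
      exact Finset.mem_coe.2 (Finset.mem_filter.2
        ⟨Finset.mem_univ _, ⟨rfl, rfl⟩, ⟨rfl, hR, rfl⟩, rfl, hm.1.2⟩)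
    · rfl
  · rintro ⟨i, j, u, v⟩ h
    simp only [Finset.mem_filter, Finset.mem_univ, true_and] at h
    dsimp only
    rw [if_pos h.2.1.2.1]
    exact hg i j u v h.1.1 h.1.2 h.2.1.1 h.2.1.2.1 h.2.1.2.2 h.2.2.1 h.2.2.2

end Sums

/-! ### The differential on generators and on products of two generators. -/

section Differential

variable (k : ℂ)

/-- The operators `e_{i,j}[-1]`, extended by zero to all positions. -/
noncomputable def eExt (c x d y : ℕ) : Module.End ℂ (Q.Va k) :=
  Q.ext2 (fun i j => Q.ea k i j (-1)) c x d y

/-- The operators `ψ_{i,j}[n]`, extended by zero to all positions. -/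
noncomputable def psiExt (n : ℤ) (c x d y : ℕ) : Module.End ℂ (Q.Va k) :=
  Q.ext2 (fun i j => Q.psi k i j n) c x d y

variable {k}

theorem eExt_box (i j : Q.Box) : Q.eExt k (col i) (row i) (col j) (row j) = Q.ea k i j (-1) :=
  Q.ext2_box _ i j

theorem psiExt_box (n : ℤ) (i j : Q.Box) :
    Q.psiExt k n (col i) (row i) (col j) (row j) = Q.psi k i j n :=
  Q.ext2_box _ i j

theorem eExt_left_zero {c x : ℕ} (h : (c, x) ∉ Q.boxes) (d y : ℕ) : Q.eExt k c x d y = 0 :=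
  Q.ext2_left_zero _ h d y

theorem psiExt_left_zero {c x : ℕ} (h : (c, x) ∉ Q.boxes) (n : ℤ) (d y : ℕ) :
    Q.psiExt k n c x d y = 0 := Q.ext2_left_zero _ h d y

theorem psiExt_right_zero {d y : ℕ} (h : (d, y) ∉ Q.boxes) (n : ℤ) (c x : ℕ) :
    Q.psiExt k n c x d y = 0 := Q.ext2_right_zero _ h c x

variable (k)

/-- The linear map `φ` allows both uses: the identity for operators, evaluation at the vacuum for
states. -/
theorem sum_hat {M : Type} [AddCommGroup M] [Module ℂ M] (φ : Module.End ℂ (Q.Va k) →ₗ[ℂ] M)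
    (n : ℤ) (i j : Q.Box) : ∑ r : Q.Box with col r = col i + 1 ∧ row r = row i, φ (Q.psi k r j n)
      = φ (Q.psiExt k n (col i + 1) (row i) (col j) (row j)) := by
  refine Q.sum_single_box _ _ _ _ ?_ fun h => by rw [Q.psiExt_left_zero h, map_zero]
  intro r h1 h2
  rw [← h1, ← h2, psiExt_box]

theorem sum_tilde {M : Type} [AddCommGroup M] [Module ℂ M] (φ : Module.End ℂ (Q.Va k) →ₗ[ℂ] M)
    (n : ℤ) (i j : Q.Box) : ∑ r : Q.Box with col r + 1 = col j ∧ row r = row j, φ (Q.psi k i r n)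
      = φ (Q.psiExt k n (col i) (row i) (col j - 1) (row j)) := by
  have hj := Q.one_le_col j
  -- Since `col j ≥ 1`, the subtraction is not truncated; for `col j = 1` the target is the empty
  -- column 0 and the term drops out.
  have e : (Finset.univ.filter fun r : Q.Box => col r + 1 = col j ∧ row r = row j)
      = Finset.univ.filter fun r : Q.Box => col r = col j - 1 ∧ row r = row j :=
    Finset.filter_congr fun r _ => by omega
  rw [e]
  refine Q.sum_single_box _ _ _ _ ?_ fun h => by rw [Q.psiExt_right_zero h, map_zero]
  intro r h1 h2
  rw [← h1, ← h2, psiExt_box]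

/-- Both ranges for `col r` in the quadratic terms are empty here, and the derivative term needs
`col j < col i`. All modes are needed: `n = -2` serves the `γ` terms. -/
theorem dField_of_col_eq (i j : Q.Box) (h : col i = col j) (n : ℤ) :
    Q.dField k i j n = Q.psiExt k n (col i + 1) (row i) (col j) (row j)
      - Q.psiExt k n (col i) (row i) (col j - 1) (row j) := by
  have h1 := Q.sum_hat k LinearMap.id n i j
  have h2 := Q.sum_tilde k LinearMap.id n i j
  simp only [LinearMap.id_apply] at h1 h2
  unfold dField
  rw [h1, h2, if_neg (by omega), Finset.sum_eq_zero, Finset.sum_eq_zero]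
  · simp
  · intro r hr
    rw [Finset.mem_filter] at hr
    omega
  · intro r hr
    rw [Finset.mem_filter] at hr
    omega

theorem d0_eb_of_col_eq (i j : Q.Box) (h : col i = col j) (n : ℤ) :
    Q.d0 k (Q.eb k i j n (Q.bTable k).vac)
      = Q.psiExt k n (col i + 1) (row i) (col j) (row j) (Q.aTable k).vac
      - Q.psiExt k n (col i) (row i) (col j - 1) (row j) (Q.aTable k).vac := by
  rw [Q.d0_mode k i j h.ge, d0_vac, map_zero, add_zero, incl_vac, Q.dField_of_col_eq k i j h]
  rfl

theorem d0_eb_of_col_eq_succ (i j : Q.Box) (h : col i = col j + 1) :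
    Q.d0 k (Q.eb k i j (-1) (Q.bTable k).vac)
      = ∑ x ∈ Finset.range (Q.q 1 + 1),
          (Q.eExt k (col j) x (col j) (row j)
              (Q.psiExt k (-1) (col j + 1) (row i) (col j) x (Q.aTable k).vac)
            - Q.psiExt k (-1) (col j + 1) x (col j) (row j)
              (Q.eExt k (col j + 1) (row i) (col j + 1) x (Q.aTable k).vac))
        + Q.zeta k (col j + 1) • Q.psiExt k (-2) (col j + 1) (row i) (col j) (row j)
            (Q.aTable k).vac
        + (Q.psiExt k (-1) (col j + 2) (row i) (col j) (row j) (Q.aTable k).vac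
          - Q.psiExt k (-1) (col j + 1) (row i) (col j - 1) (row j) (Q.aTable k).vac) := by
  have h1 := Q.sum_hat k (LinearMap.applyₗ (Q.aTable k).vac) (-1) i j
  have h2 := Q.sum_tilde k (LinearMap.applyₗ (Q.aTable k).vac) (-1) i j
  simp only [LinearMap.applyₗ_apply_apply] at h1 h2
  rw [Q.d0_gen k i j (by omega), h1, h2, if_pos (by omega), ← psiExt_box, Finset.sum_sub_distrib,
    ← h]
  -- For adjacent columns each range of `col r` is a single column: `col j` in the first sum, `col
  -- i` in the second.
  have f1 : (Finset.univ.filter fun r : Q.Box => col j ≤ col r ∧ col r < col i)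
      = Finset.univ.filter fun r : Q.Box => col r = col j :=
    Finset.filter_congr fun r _ => by omega
  have f2 : (Finset.univ.filter fun r : Q.Box => col j < col r ∧ col r ≤ col i)
      = Finset.univ.filter fun r : Q.Box => col r = col i :=
    Finset.filter_congr fun r _ => by omega
  rw [f1, f2]
  rw [Q.sum_col_eq (col j) _ (fun x => Q.eExt k (col j) x (col j) (row j)
      (Q.psiExt k (-1) (col i) (row i) (col j) x (Q.aTable k).vac)),
    Q.sum_col_eq (col i) _ (fun x => Q.psiExt k (-1) (col i) x (col j) (row j)
      (Q.eExt k (col i) (row i) (col i) x (Q.aTable k).vac))]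
  · rw [show col j + 2 = col i + 1 by omega]
    abel
  · intro r hr
    rw [← eExt_box, ← psiExt_box, hr]
  · intro x hx
    rw [Q.psiExt_left_zero hx]; rfl
  · intro r hr
    rw [← eExt_box, ← psiExt_box, hr]
  · intro x hx
    rw [Q.eExt_left_zero hx]; rfl

/-- Leibniz rule without signs, the `e` being even. Both factors stay within a column, so their
differentials are linear in `ψ` and no normally ordered product appears. -/
theorem d0_eb_eb (i j u v : Q.Box) (huj : col u = col j) (hiv : col i = col v) :
    Q.d0 k (Q.eb k u j (-1) (Q.eb k i v (-1) (Q.bTable k).vac))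
      = (Q.psiExt k (-1) (col u + 1) (row u) (col j) (row j)
            (Q.eExt k (col i) (row i) (col v) (row v) (Q.aTable k).vac)
          - Q.psiExt k (-1) (col u) (row u) (col j - 1) (row j)
            (Q.eExt k (col i) (row i) (col v) (row v) (Q.aTable k).vac))
        + (Q.eExt k (col u) (row u) (col j) (row j)
            (Q.psiExt k (-1) (col i + 1) (row i) (col v) (row v) (Q.aTable k).vac)
          - Q.eExt k (col u) (row u) (col j) (row j)
            (Q.psiExt k (-1) (col i) (row i) (col v - 1) (row v) (Q.aTable k).vac)) := by
  rw [Q.d0_mode k u j huj.ge, incl_mode, incl_vac, Q.d0_eb_of_col_eq k i v hiv,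
    Q.dField_of_col_eq k u j huj, map_sub, eExt_box, eExt_box]
  rfl

/-! ### Vanishing at the ends of rows, and the elements `W1` and `W2`. -/

variable {a b p q : ℕ}

theorem notMem_of_lt {c d x : ℕ} (hc : (c, x) ∉ Q.boxes) (h1 : 1 ≤ c) (h : c ≤ d) :
    (d, x) ∉ Q.boxes := fun hd => hc (Q.mem_boxes_of_col_le hd h1 h)

/-- Past its end a row stays empty, so column `c + 1` is missing too. For `c = 0` the position in
row `p` may be a box, but then the other one lies in column 0. -/
theorem psiExt_succ_eq_zero {c : ℕ} (hc : (c, p) ∉ Q.boxes) (n : ℤ) (y : ℕ) :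
    Q.psiExt k n (c + 1) p c y = 0 := by
  rcases Nat.eq_zero_or_pos c with rfl | h
  · exact Q.psiExt_right_zero (Q.zero_notMem y) _ _ _
  · exact Q.psiExt_left_zero (Q.notMem_of_lt hc h (by omega)) _ _ _

/-- The form `c - 1 + 1` is the value at `c - 1` of the telescoping function. It is column `c` for
`c ≥ 1`; for `c = 0` it is column 1, and the second position, in column 0, gives zero. -/
theorem psiExt_pred_eq_zero {c : ℕ} (hc : (c, p) ∉ Q.boxes) (n : ℤ) (y : ℕ) :
    Q.psiExt k n (c - 1 + 1) p (c - 1) y = 0 := by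
  rcases Nat.eq_zero_or_pos c with rfl | h
  · exact Q.psiExt_right_zero (Q.zero_notMem y) _ _ _
  · rw [Nat.sub_add_cancel h]
    exact Q.psiExt_left_zero hc _ _ _

theorem W1_mem_wAlgebra (hle : ∀ c, (c, p) ∈ Q.boxes → (c, q) ∈ Q.boxes) :
    Q.W1 k p q ∈ Q.wAlgebra k := by
  rw [wAlgebra, LinearMap.mem_ker, W1, map_sum]
  rw [Q.sum_pairs_of_col_eq p q _ (fun c => Q.psiExt k (-1) (c + 1) p c q (Q.aTable k).vac
    - Q.psiExt k (-1) (c - 1 + 1) p (c - 1) q (Q.aTable k).vac)]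
  · rw [sum_range_sub_pred (fun c => Q.psiExt k (-1) (c + 1) p c q (Q.aTable k).vac),
      Q.psiExt_left_zero (Q.width_succ_notMem p)]
    · rfl
    · rw [Q.psiExt_right_zero (Q.zero_notMem q)]; rfl
  · intro i j hi hj h
    rw [Q.d0_eb_of_col_eq k i j h, hi, hj, h, Nat.sub_add_cancel (Q.one_le_col j)]
  · intro c hc
    -- Row `p` is the shorter one, so a missing pair means that row `p` has ended (or `c = 0`), and
    -- both terms of the difference vanish separately.
    have hp : (c, p) ∉ Q.boxes := fun h => hc ⟨h, hle c h⟩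
    rw [Q.psiExt_succ_eq_zero k hp, Q.psiExt_pred_eq_zero k hp, sub_self]

/-- The differential of the linear terms without derivatives. -/
theorem d0_sum_col_succ (hle : ∀ c, (c, p) ∈ Q.boxes → (c, q) ∈ Q.boxes) :
    Q.d0 k (∑ x : Q.Box × Q.Box with row x.1 = p ∧ row x.2 = q ∧ col x.1 = col x.2 + 1,
        Q.eb k x.1 x.2 (-1) (Q.bTable k).vac)
      = ∑ c ∈ Finset.range (Q.width + 1), (∑ x ∈ Finset.range (Q.q 1 + 1),
          (Q.eExt k c x c q (Q.psiExt k (-1) (c + 1) p c x (Q.aTable k).vac)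
            - Q.psiExt k (-1) (c + 1) x c q (Q.eExt k (c + 1) p (c + 1) x (Q.aTable k).vac))
        + Q.zeta k (c + 1) • Q.psiExt k (-2) (c + 1) p c q (Q.aTable k).vac) := by
  -- The linear part of the differential sums to zero. It is added to the right-hand side in this
  -- form so that the two sides can be compared column by column.
  have ht := sum_range_sub_pred (fun c => Q.psiExt k (-1) (c + 2) p c q (Q.aTable k).vac)
    (by rw [Q.psiExt_right_zero (Q.zero_notMem q)]; rfl) Q.width
  rw [Q.psiExt_left_zero (Q.notMem_of_lt (Q.width_succ_notMem p) (by omega) (by omega)),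
    LinearMap.zero_apply] at ht
  rw [map_sum, ← add_zero (∑ c ∈ Finset.range (Q.width + 1), _), ← ht, ← Finset.sum_add_distrib]
  refine Q.sum_pairs 1 p q _ _ ?_ ?_
  · intro i j hi hj h
    have := Q.one_le_col j
    rw [Q.d0_eb_of_col_eq_succ k i j h, hi, hj, show col j - 1 + 2 = col j + 1 by omega]
  · intro c hc
    rcases Nat.eq_zero_or_pos c with rfl | h
    · simp [Q.psiExt_right_zero (Q.zero_notMem _), Q.eExt_left_zero (Q.zero_notMem _)]
    -- A box `(c + 1, p)` would give `(c + 1, q)`, hence `(c, q)`; so the missing box is in row `p`,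
    -- and it occurs in every summand.
    · have hp : (c + 1, p) ∉ Q.boxes := fun h' =>
        hc ⟨h', Q.mem_boxes_of_col_le (hle _ h') h (by omega)⟩
      rw [show c - 1 + 2 = c + 1 by omega, Q.psiExt_left_zero hp, Q.psiExt_left_zero hp,
        Q.psiExt_left_zero (Q.notMem_of_lt hp (by omega) (by omega))]
      simp [Q.psiExt_left_zero hp, Q.eExt_left_zero hp]

/-- The differential of the linear terms with derivatives. -/
theorem d0_sum_gamma (hle : ∀ c, (c, p) ∈ Q.boxes → (c, q) ∈ Q.boxes) :
    Q.d0 k (∑ x : Q.Box × Q.Box with row x.1 = p ∧ row x.2 = q ∧ col x.1 = col x.2,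
        Q.gamma k (col x.1) • Q.eb k x.1 x.2 (-2) (Q.bTable k).vac)
      = ∑ c ∈ Finset.range (Q.width + 1),
          Q.zeta k (c + 1) • Q.psiExt k (-2) (c + 1) p c q (Q.aTable k).vac := by
  set F : ℕ → Q.Va k := fun c => Q.psiExt k (-2) (c + 1) p c q (Q.aTable k).vac with hF
  have F0 : F 0 = 0 := by
    rw [hF]
    simp only [Q.psiExt_right_zero (Q.zero_notMem q), LinearMap.zero_apply]
  have Fw : F Q.width = 0 := by
    rw [hF]
    simp only [Q.psiExt_left_zero (Q.width_succ_notMem p), LinearMap.zero_apply]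
  rw [map_sum, Q.sum_pairs_of_col_eq p q _ (fun c => Q.gamma k c • (F c - F (c - 1)))]
  -- Summation by parts with `γ_{c-1} = ζ_c + γ_c`. At `c = 0` this recursion is not used, as `F 0 =
  -- 0`.
  · have hs : ∀ c ∈ Finset.range (Q.width + 1), Q.gamma k c • (F c - F (c - 1))
        = (Q.gamma k c • F c - Q.gamma k (c - 1) • F (c - 1)) + Q.zeta k c • F (c - 1) := by
      intro c hc
      rw [Finset.mem_range] at hc
      rcases c with _ | c
      · simp [F0]
      · rw [Nat.add_sub_cancel, Q.gamma_eq k (c := c) (by omega)]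
        module
    rw [Finset.sum_congr rfl hs, Finset.sum_add_distrib,
      sum_range_sub_pred (fun c => Q.gamma k c • F c) (by simp [F0]), Fw, smul_zero, zero_add]
    exact sum_pred_eq_sum_succ (fun c d => Q.zeta k d • F c) _ (by simp [F0]) (by simp [Fw])
  · intro i j hi hj h
    rw [map_smul, Q.d0_eb_of_col_eq k i j h, hi, hj, h]
    simp only [hF, Nat.sub_add_cancel (Q.one_le_col j)]
  · intro c hc
    have hp : (c, p) ∉ Q.boxes := fun h => hc ⟨h, hle c h⟩
    simp only [hF]
    rw [Q.psiExt_succ_eq_zero k hp, Q.psiExt_pred_eq_zero k hp, sub_self, smul_zero]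

/-- The vectors `ψ_{(x,c+1),(q,c)}[-1] e_{(p,d),(x,d)}[-1]|0⟩`, each box written as (row, column). -/
noncomputable def psiE (p q x c d : ℕ) : Q.Va k :=
  Q.psiExt k (-1) (c + 1) x c q (Q.eExt k d p d x (Q.aTable k).vac)

/-- The vectors `e_{(x,c),(q,c)}[-1] ψ_{(p,d+1),(x,d)}[-1]|0⟩`, each box written as (row, column). -/
noncomputable def ePsi (p q x c d : ℕ) : Q.Va k :=
  Q.eExt k c x c q (Q.psiExt k (-1) (d + 1) p d x (Q.aTable k).vac)

theorem d0_quadratic (i j u v : Q.Box) (hi : row i = p) (hj : row j = q)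
    (huj : col u = col j) (hiv : col i = col v) (huv : row u = row v) :
    Q.d0 k (Q.eb k u j (-1) (Q.eb k i v (-1) (Q.bTable k).vac))
      = (Q.psiE k p q (row u) (col j) (col i) - Q.psiE k p q (row u) (col j - 1) (col i))
        + (Q.ePsi k p q (row u) (col j) (col i) - Q.ePsi k p q (row u) (col j) (col i - 1)) := by
  rw [Q.d0_eb_eb k i j u v huj hiv, psiE, psiE, ePsi, ePsi, Nat.sub_add_cancel (Q.one_le_col j),
    Nat.sub_add_cancel (Q.one_le_col i), hi, hj, huj, ← hiv, ← huv]

/-- Together with `psiE_width`, `ePsi_zero_right` and `ePsi_width`, these are the boundary values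
for the two-dimensional telescoping: one position lies in column 0 or `width + 1`. -/
theorem psiE_zero_left (p q x d : ℕ) : Q.psiE k p q x 0 d = 0 := by
  rw [psiE, Q.psiExt_right_zero (Q.zero_notMem q), LinearMap.zero_apply]

theorem psiE_width (p q x d : ℕ) : Q.psiE k p q x Q.width d = 0 := by
  rw [psiE, Q.psiExt_left_zero (Q.width_succ_notMem x), LinearMap.zero_apply]

theorem psiE_of_notMem {d : ℕ} (h : (d, p) ∉ Q.boxes) (q x c : ℕ) : Q.psiE k p q x c d = 0 := by
  rw [psiE, Q.eExt_left_zero h, LinearMap.zero_apply, map_zero]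

theorem ePsi_zero_right (p q x c : ℕ) : Q.ePsi k p q x c 0 = 0 := by
  rw [ePsi, Q.psiExt_right_zero (Q.zero_notMem x), LinearMap.zero_apply, map_zero]

theorem ePsi_width (p q x c : ℕ) : Q.ePsi k p q x c Q.width = 0 := by
  rw [ePsi, Q.psiExt_left_zero (Q.width_succ_notMem p), LinearMap.zero_apply, map_zero]

theorem ePsi_of_notMem {c x : ℕ} (h : (c, x) ∉ Q.boxes) (p q d : ℕ) : Q.ePsi k p q x c d = 0 := by
  rw [ePsi, Q.eExt_left_zero h, LinearMap.zero_apply]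

/-- The two `ψ` have first positions `(d + 1, p)` and `(d, p)`, both past the end of row `p`. In
`psiE_sub_of_notMem` row `x` plays this part. -/
theorem ePsi_sub_of_notMem {d : ℕ} (h : (d, p) ∉ Q.boxes) (q x c : ℕ) :
    Q.ePsi k p q x c d - Q.ePsi k p q x c (d - 1) = 0 := by
  rw [ePsi, ePsi, Q.psiExt_succ_eq_zero k h, Q.psiExt_pred_eq_zero k h, sub_self]

theorem psiE_sub_of_notMem {c x : ℕ} (h : (c, x) ∉ Q.boxes) (p q d : ℕ) :
    Q.psiE k p q x c d - Q.psiE k p q x (c - 1) d = 0 := by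
  rw [psiE, psiE, Q.psiExt_succ_eq_zero k h, Q.psiExt_pred_eq_zero k h, sub_self]

/-- The differential of the quadratic terms with `col j < col i`, summed over long rows. -/
theorem d0_sum_long (t : ℕ) (hle : ∀ c, (c, p) ∈ Q.boxes → (c, q) ∈ Q.boxes)
    (hlong : ∀ c x, t < x → x ≤ Q.q 1 → (c, q) ∈ Q.boxes → (c, x) ∈ Q.boxes) :
    Q.d0 k (∑ y : Q.Box × Q.Box × Q.Box × Q.Box with
        (row y.1 = p ∧ row y.2.1 = q) ∧
        (col y.2.2.1 = col y.2.1 ∧ col y.2.1 < col y.1 ∧ col y.1 = col y.2.2.2) ∧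
        (row y.2.2.1 = row y.2.2.2 ∧ t < row y.2.2.1),
      Q.eb k y.2.2.1 y.2.1 (-1) (Q.eb k y.1 y.2.2.2 (-1) (Q.bTable k).vac))
      = ∑ x ∈ Finset.range (Q.q 1 + 1) with t < x, ∑ c ∈ Finset.range (Q.width + 1),
          (Q.psiE k p q x c (c + 1) - Q.ePsi k p q x c c) := by
  rw [map_sum, Q.sum_quadruples p q (fun c d => c < d) (fun x => t < x) _ (fun x c d =>
    (Q.psiE k p q x c d - Q.psiE k p q x (c - 1) d)
      + (Q.ePsi k p q x c d - Q.ePsi k p q x c (d - 1)))]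
  · refine Finset.sum_congr rfl fun x _ => ?_
    exact sum_telescope_lt (Q.psiE k p q x) (Q.ePsi k p q x) Q.width (Q.psiE_zero_left k p q x)
      (Q.psiE_width k p q x) (Q.ePsi_zero_right k p q x) (Q.ePsi_width k p q x)
  · intro i j u v hi hj huj _ hiv huv _
    exact Q.d0_quadratic k i j u v hi hj huj hiv huv
  · intro x c d hcd hx hx1 h
    -- Column 0 is in the range of summation but lies outside the pyramid, so left-justification of
    -- rows does not reach it.
    rcases Nat.eq_zero_or_pos c with rfl | hc
    · simp only [Nat.zero_sub, psiE_zero_left, Q.ePsi_of_notMem k (Q.zero_notMem x), sub_self,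
        add_zero]
    -- A box `(d, p)` puts rows `q` and, being long, `x` into column `d`, hence into column `c < d`:
    -- nothing would be missing.
    · have hp : (d, p) ∉ Q.boxes := by
        intro hp
        have hd := hlong d x hx hx1 (hle d hp)
        exact h ⟨hp, Q.mem_boxes_of_col_le (hle d hp) hc hcd.le,
          Q.mem_boxes_of_col_le hd hc hcd.le, hd⟩
      rw [Q.psiE_of_notMem k hp, Q.psiE_of_notMem k hp, Q.ePsi_sub_of_notMem k hp, sub_self,
        add_zero]

/-- The differential of the quadratic terms with `col j ≥ col i`, summed over short rows. -/
theorem d0_sum_short (t : ℕ)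
    (hshort : ∀ c x, x ≤ t → (c, x) ∈ Q.boxes → (c, q) ∈ Q.boxes) :
    Q.d0 k (∑ y : Q.Box × Q.Box × Q.Box × Q.Box with
        (row y.1 = p ∧ row y.2.1 = q) ∧
        (col y.2.2.1 = col y.2.1 ∧ col y.1 ≤ col y.2.1 ∧ col y.1 = col y.2.2.2) ∧
        (row y.2.2.1 = row y.2.2.2 ∧ row y.2.2.1 ≤ t),
      Q.eb k y.2.2.1 y.2.1 (-1) (Q.eb k y.1 y.2.2.2 (-1) (Q.bTable k).vac))
      = ∑ x ∈ Finset.range (Q.q 1 + 1) with x ≤ t, -∑ c ∈ Finset.range (Q.width + 1),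
          (Q.psiE k p q x c (c + 1) - Q.ePsi k p q x c c) := by
  rw [map_sum, Q.sum_quadruples p q (fun c d => d ≤ c) (fun x => x ≤ t) _ (fun x c d =>
    (Q.psiE k p q x c d - Q.psiE k p q x (c - 1) d)
      + (Q.ePsi k p q x c d - Q.ePsi k p q x c (d - 1)))]
  · refine Finset.sum_congr rfl fun x _ => ?_
    exact sum_telescope_ge (Q.psiE k p q x) (Q.ePsi k p q x) Q.width (Q.psiE_zero_left k p q x)
      (Q.psiE_width k p q x) (Q.ePsi_zero_right k p q x)
  · intro i j u v hi hj huj _ hiv huv _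
    exact Q.d0_quadratic k i j u v hi hj huj hiv huv
  · intro x c d hdc hx _ h
    -- If `(c, x)` is a box, so are `(c, q)`, since row `x` is short, and `(d, x)` for `1 ≤ d ≤ c`,
    -- so only `(d, p)` can be missing. Otherwise row `x` has ended: the `e` of `ePsi` and both `ψ`
    -- of the `psiE` difference vanish.
    by_cases hc : (c, x) ∈ Q.boxes
    · have hp : (d, p) ∉ Q.boxes := by
        intro hp
        have h1 : 1 ≤ d := (Q.mem_boxes.1 hp).1.1
        exact h ⟨hp, hshort c x hx hc, hc, Q.mem_boxes_of_col_le hc h1 hdc⟩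
      rw [Q.psiE_of_notMem k hp, Q.psiE_of_notMem k hp, Q.ePsi_sub_of_notMem k hp, sub_self,
        add_zero]
    · rw [Q.psiE_sub_of_notMem k hc, Q.ePsi_of_notMem k hc, Q.ePsi_of_notMem k hc, sub_self,
        add_zero]

theorem W2_mem_wAlgebra (hle : ∀ c, (c, p) ∈ Q.boxes → (c, q) ∈ Q.boxes)
    (hlong : ∀ c x, Q.q 1 - Q.q a < x → x ≤ Q.q 1 → (c, q) ∈ Q.boxes → (c, x) ∈ Q.boxes)
    (hshort : ∀ c x, x ≤ Q.q 1 - Q.q a → (c, x) ∈ Q.boxes → (c, q) ∈ Q.boxes) :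
    Q.W2 k a p q ∈ Q.wAlgebra k := by
  rw [wAlgebra, LinearMap.mem_ker, W2, map_sub, map_add, map_sub, Q.d0_sum_col_succ k hle,
    Q.d0_sum_gamma k hle, Q.d0_sum_long k _ hle hlong, Q.d0_sum_short k _ hshort,
    Finset.sum_neg_distrib, sub_neg_eq_add, add_assoc, ← Finset.sum_sub_distrib]
  -- The `ψ[-2]` terms cancel column by column.
  simp only [add_sub_cancel_right]
  have hf := Finset.sum_filter_add_sum_filter_not (Finset.range (Q.q 1 + 1))
    (fun x => Q.q 1 - Q.q a < x) (fun x => ∑ c ∈ Finset.range (Q.width + 1),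
      (Q.psiE k p q x c (c + 1) - Q.ePsi k p q x c c))
  simp only [not_lt] at hf
  -- Long and short rows together make up all rows `x`, matching the unrestricted sum over `x` from
  -- the linear terms.
  rw [hf, Finset.sum_comm, ← Finset.sum_add_distrib]
  refine Finset.sum_eq_zero fun c _ => ?_
  rw [← Finset.sum_add_distrib]
  refine Finset.sum_eq_zero fun x _ => ?_
  rw [psiE, ePsi]
  abel

end Differential

end Pyramid
end WAlgebraTypeA

theorem mainTheorem2 (Q : WAlgebraTypeA.Pyramid) (k : ℂ) (a b p q : ℕ)
    (hb : 1 ≤ b) (hba : b ≤ a) (ha : a ≤ Q.s)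
    (hq : Q.q 1 - Q.q a < q ∧ q ≤ Q.q 1 - Q.q (a + 1))
    (hp : Q.q 1 - Q.q b < p ∧ p ≤ Q.q 1 - Q.q (b + 1)) :
    Q.W1 k p q ∈ Q.wAlgebra k ∧ Q.W2 k a p q ∈ Q.wAlgebra k := by
  -- Here `b ≤ a` is decisive: the range of `p` ends at `q₁ - q_{b+1} ≤ q₁ - q_{a+1}`, while `q`
  -- lies beyond `q₁ - q_a`, so row `p` is at most as long as row `q`.
  have hle : ∀ c, (c, p) ∈ Q.boxes → (c, q) ∈ Q.boxes := by
    intro c h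
    have := Q.q_antitone (u := b + 1) (v := a + 1) (by omega) (by omega) (by omega)
    exact Q.mem_boxes_of_range (hb.trans hba) ha h (by omega) hq.1 (by omega)
  refine ⟨Q.W1_mem_wAlgebra k hle, Q.W2_mem_wAlgebra k hle ?_ ?_⟩
  -- Row `q` now has the role of the row up to the end of the `a`-th range.
  · intro c x hx hx1 h
    exact Q.mem_boxes_of_range (hb.trans hba) ha h hq.2 hx hx1
  -- Here `x ≤ q₁ - q_a < q`, and row length grows with the row index.
  · intro c x hx h
    exact Q.mem_boxes_of_row_le h (by omega) (by omega)
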